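/- **Setting.** A memoryless network with nodes $1,\dots,m$ is a transition law $p(\mathbf y\mid\mathbf x)$ from the vector $\mathbf x=(x^{(1)},\dots,x^{(m)})$ of channel inputs to the vector $\mathbf y=(y^{(1)},\dots,y^{(m)})$ of channel outputs, where the alphabets $\mathcal X^{(v)},\mathcal Y^{(v)}$ are arbitrary measurable spaces (discrete or continuous). A rate vector is $\mathcal R=(R^{u\to v})_{u,v}$ with $R^{u\to v}\ge 0$ and $R^{v\to v}=0$. For each pair of nodes there is a message $W^{u\to v}$; all messages are independent and each is uniform on a set with $\lceil 2^{nR^{u\to v}}\rceil$ elements. A blocklength-$n$ solution consists of measurable encoders giving $X^{(v)}_t$ as a function of $Y^{(v)}_1,\dots,Y^{(v)}_{t-1}$ and $(W^{v\to v'})_{v'}$, for $t=1,\dots,n$, and measurable decoders giving $\hat W^{u\to v}$ as a function of $Y^{(v)}_1,\dots,Y^{(v)}_n$ and $(W^{v\to v'})_{v'}$. It is a $(\lambda,\mathcal R)$-solution if $\Pr(\hat W^{u\to v}\ne W^{u\to v})<\lambda$ for all $u,v$. The rate region $\mathscr R(\mathcal N)$ of a network $\mathcal N$ is the closure of the set of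 rate vectors $\mathcal R$ such that for every $\lambda>0$ and all sufficiently large $n$ there is a $(\lambda,\mathcal R)$-solution of blocklength $n$. Let $\mathcal N$ be a network that contains an independent point-to-point channel from node $i$ to node $j$: $\mathcal X^{(i)}=\mathcal X^{(i,1)}\times\mathcal X^{(i,2)}$ with $\mathcal X^{(i,1)}\neq\emptyset$, $\mathcal Y^{(j)}=\mathcal Y^{(j,1)}\times\mathcal Y^{(j,2)}$, and $$p(\mathbf y\mid\mathbf x)=p(y^{(j,1)}\mid x^{(i,1)})\;p(y^{-(j,1)}\mid x^{-(i,1)}),$$ where $x^{-(i,1)}$ and $y^{-(j,1)}$ denote the remaining inputs and outputs. Let $C=\sup_{p(x^{(i,1)})}I(X^{(i,1)};Y^{(j,1)})$, in bits, be the capacity of the channel $p(y^{(j,1)}\mid x^{(i,1)})$, and assume $C<\infty$. Let $\mathcal N_C$ be the network obtained from $\mathcal N$ by replacing this channel by a noiseless bit pipe of rate $C$ from $i$ to $j$: $$\mathcal N_C=\bigl(\mathcal X^{-(i,1)}\times\{0,1\}^C,\ \delta(\tilde y^{(j,1)}-\tilde x^{(i,1)})\,p(y^{-(j,1)}\mid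 x^{-(i,1)}),\ \mathcal Y^{-(j,1)}\times\{0,1\}^C\bigr).$$ If $C$ is an integer, this is a network as above. For arbitrary real $C\ge 0$, the network is given meaning through its $N$-fold stacks: the $N$-fold stacked network consists of $N$ independent copies of the remainder $p(y^{-(j,1)}\mid x^{-(i,1)})$ of the network together with one noiseless pipe that carries $\lfloor NC\rfloor$ bits per time step from $i$ to $j$; the $N$ copies of each node collaborate. A blocklength-$n$ $(\lambda,\mathcal R)$-solution of the stack conveys from $u$ to $v$ a vector of $N$ messages, each with $\lceil 2^{nR^{u\to v}}\rceil$ values, where all messages are independent and uniform and the probability that the vector is not recovered correctly in all $N$ layers is less than $\lambda$ for each pair $u,v$. The stacked rate region $\mathscr R(\underline{\mathcal N}_C)$ is the closure of the set of rate vectors $\mathcal R$ such that for every $\lambda>0$ and all sufficiently large $N$ there is a $(\lambda,\mathcal R)$-solution of the $N$-fold stack, of some blocklength $n\ge1$. **Lemma.** Replacing the channel by a noiseless bit pipe of rate equal to its capacity gives a subset of the rate region, $\mathscr R(\mathcal N_C)\subseteq\mathscr R(\mathcal N)$. That is: $\mathscr R(\underline{\mathcal N}_C)\subseteq\mathscr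 R(\mathcal N)$ for every real value of $C\geq 0$, and, if $C$ is an integer, also $\mathscr R(\mathcal N_C)\subseteq\mathscr R(\mathcal N)$ for the network $\mathcal N_C$ itself. -/

import Mathlib

open MeasureTheory ProbabilityTheory Filter
open scoped ENNReal NNReal

namespace NetEquiv

universe u v u' v'

/-! ### Memoryless networks -/

/-- A memoryless network with node set `Fin m`, input alphabets `X v` and output alphabets `Y v`
is a transition law from the vector of all channel inputs to the vector of all channel outputs
(the networks below are all Markov kernels). -/
abbrev Network {m : ℕ} (X : Fin m → Type u) (Y : Fin m → Type v)
    [∀ v, MeasurableSpace (X v)] [∀ v, MeasurableSpace (Y v)] :=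
  Kernel (∀ v, X v) (∀ v, Y v)

/-- The number of messages of a rate-`r` source at blocklength `n`: `2 ^ (n r)`, rounded up to an
integer. -/
noncomputable def numMessages (n : ℕ) (r : ℝ) : ℕ := ⌈(2 : ℝ) ^ ((n : ℝ) * r)⌉₊

/-- A blocklength-`n` solution with message alphabets `M u v` (the message from node `u` to node
`v`).  The input of node `v` at time `t` is a measurable function of the `t` outputs that `v`
received earlier and of the messages that originate at `v`; at the end, `v` estimates each message
intended for it from all its outputs and its own messages. -/
structure Solution {m : ℕ} (X : Fin m → Type u) (Y : Fin m → Type v)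
    [∀ v, MeasurableSpace (X v)] [∀ v, MeasurableSpace (Y v)]
    (M : Fin m → Fin m → Type) (n : ℕ) where
  enc : ∀ (t : Fin n) (v : Fin m), (Fin t → Y v) → (∀ v', M v v') → X v
  dec : ∀ u v : Fin m, (Fin n → Y v) → (∀ v', M v v') → M u v
  measurable_enc : ∀ t v w, Measurable fun y => enc t v y w
  measurable_dec : ∀ u v w w', MeasurableSet {y | dec u v y w = w'}

namespace Solution

variable {m : ℕ} {X : Fin m → Type u} {Y : Fin m → Type v}
  [∀ v, MeasurableSpace (X v)] [∀ v, MeasurableSpace (Y v)]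
  {M : Fin m → Fin m → Type} {n : ℕ}

/-- The vector of all inputs at time `t`, given the messages and the earlier outputs. -/
def inputs (S : Solution X Y M n) (w : ∀ u v, M u v) (t : Fin n)
    (y : Fin t → ∀ v, Y v) : ∀ v, X v :=
  fun v => S.enc t v (fun s => y s v) (w v)

lemma measurable_inputs (S : Solution X Y M n) (w : ∀ u v, M u v) (t : Fin n) :
    Measurable (S.inputs w t) := by
  refine measurable_pi_lambda _ fun v => (S.measurable_enc t v (w v)).comp ?_
  fun_prop

/-- The law of the outputs of the first `t` time steps when the solution is run on the network `K`
with messages `w`. -/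
noncomputable def outputLaw (S : Solution X Y M n) (K : Network X Y) (w : ∀ u v, M u v) :
    (t : ℕ) → t ≤ n → Measure (Fin t → ∀ v, Y v)
  | 0, _ => Measure.dirac Fin.elim0
  | t + 1, h =>
      ((outputLaw S K w t (Nat.le_of_succ_le h)) ⊗ₘ
        (K.comap (S.inputs w ⟨t, h⟩) (S.measurable_inputs w ⟨t, h⟩))).map
          (fun p => Fin.snoc (α := fun _ => ∀ v, Y v) p.1 p.2)

/-- The probability that node `v` decodes the message from `u` incorrectly, all messages being
independent and uniformly distributed. -/
noncomputable def errorProb [∀ u v, Fintype (M u v)] (S : Solution X Y M n) (K : Network X Y)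
    (u v : Fin m) : ℝ :=
  (∑ w : (∀ u v, M u v),
      (S.outputLaw K w n le_rfl).real {y | S.dec u v (fun t => y t v) (w v) ≠ w u v}) /
    Fintype.card (∀ u v, M u v)

/-- All error probabilities are less than `lam`. -/
def IsGood [∀ u v, Fintype (M u v)] (S : Solution X Y M n) (K : Network X Y) (lam : ℝ) : Prop :=
  ∀ u v, S.errorProb K u v < lam

end Solution

/-! ### Rate regions -/

/-- Rate vectors: nonnegative, with no message from a node to itself. -/
def IsRateVector {m : ℕ} (R : Fin m → Fin m → ℝ) : Prop :=
  (∀ u v, 0 ≤ R u v) ∧ ∀ v, R v v = 0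

/-- The rate region of a network: the closure of the set of rate vectors `R` such that for every
`lam > 0` and all sufficiently large `n` there is a `(lam, R)`-solution of blocklength `n`. -/
def rateRegion {m : ℕ} {X : Fin m → Type u} {Y : Fin m → Type v}
    [∀ v, MeasurableSpace (X v)] [∀ v, MeasurableSpace (Y v)] (K : Network X Y) :
    Set (Fin m → Fin m → ℝ) :=
  closure {R | IsRateVector R ∧ ∀ lam : ℝ, 0 < lam → ∀ᶠ n : ℕ in atTop,
    ∃ S : Solution X Y (fun u v => Fin (numMessages n (R u v))) n, S.IsGood K lam}

/-! ### Stacks -/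

/-- `N` independent copies of a network, the `N` copies of a node being merged into one node.
Thus `stack K N x` is the product over the layers `l` of the laws `K (x · l)`, reordered. -/
noncomputable def stack {m : ℕ} {X : Fin m → Type u} {Y : Fin m → Type v}
    [∀ v, MeasurableSpace (X v)] [∀ v, MeasurableSpace (Y v)] (K : Network X Y)
    [IsMarkovKernel K] (N : ℕ) :
    Network (fun v => Fin N → X v) (fun v => Fin N → Y v) where
  toFun x := (Measure.pi fun l : Fin N => K fun v => x v l).map fun y v l => y l v
  measurable' := by
    refine (Measure.measurable_map _ (by fun_prop)).comp ?_
    refine Measurable.measure_of_isPiSystem_of_isProbabilityMeasure generateFrom_pi.symm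
      isPiSystem_pi ?_
    rintro _ ⟨s, hs, rfl⟩
    simp only [Measure.pi_pi]
    refine Finset.measurable_prod _ fun l _ => ?_
    exact (K.measurable_coe (hs l (Set.mem_univ l))).comp (by fun_prop)

/-- The rate region of an `N`-fold stacked network, `N → ∞`.  Here `K N` is the law of the
`N`-fold stack, viewed as a network whose node `v` stands for the `N` collaborating copies of `v`.
There are `N` messages for each pair of nodes, and a solution has to decode all of them. -/
def stackedRateRegion {m : ℕ} {X : ℕ → Fin m → Type u} {Y : ℕ → Fin m → Type v}
    [∀ N v, MeasurableSpace (X N v)] [∀ N v, MeasurableSpace (Y N v)]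
    (K : ∀ N, Network (X N) (Y N)) : Set (Fin m → Fin m → ℝ) :=
  closure {R | IsRateVector R ∧ ∀ lam : ℝ, 0 < lam → ∀ᶠ N : ℕ in atTop, ∃ n : ℕ, 0 < n ∧
    ∃ S : Solution (X N) (Y N) (fun u v => Fin N → Fin (numMessages n (R u v))) n,
      S.IsGood (K N) lam}

/-! ### Independent point-to-point channels -/

/-- The contribution of the alphabet `A` to node `v` when `A` is attached to node `i`: it is (a copy
of) `A` if `v = i`, and a one-point space otherwise. -/
abbrev AtNode {m : ℕ} (i : Fin m) (A : Type u') (v : Fin m) : Type u' := PLift (v = i) → A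

/-- The network that consists of the network `Q` and, independently of it, the point-to-point
channel `W` from node `i` to node `j`:
`p (y | x) = W (y^(j,1) | x^(i,1)) * Q (y^-(j,1) | x^-(i,1))`. -/
noncomputable def withChannel {m : ℕ} {X : Fin m → Type u} {Y : Fin m → Type v}
    [∀ v, MeasurableSpace (X v)] [∀ v, MeasurableSpace (Y v)]
    {A : Type u'} {B : Type v'} [MeasurableSpace A] [MeasurableSpace B]
    (Q : Network X Y) (i j : Fin m) (W : Kernel A B) :
    Network (fun v => X v × AtNode i A v) (fun v => Y v × AtNode j B v) :=
  ((Q ∥ₖ W).comap (fun x => ((fun v => (x v).1), (x i).2 ⟨rfl⟩)) (by fun_prop)).map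
    (fun p v => (p.1 v, fun _ => p.2))

/-- The noiseless channel with input and output alphabet `{0,1}^k`. -/
noncomputable def bitPipe (k : ℕ) : Kernel (Fin k → Bool) (Fin k → Bool) := Kernel.id

/-- The `N`-fold stacked network for the network `Q` together with an independent noiseless bit pipe
of rate `R` from node `i` to node `j`: `N` copies of `Q`, and a pipe that transmits `⌊N R⌋` bits per
time step from the copies of `i` to the copies of `j`. -/
noncomputable def stackWithBitPipe {m : ℕ} {X : Fin m → Type u} {Y : Fin m → Type v}
    [∀ v, MeasurableSpace (X v)] [∀ v, MeasurableSpace (Y v)]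
    (Q : Network X Y) [IsMarkovKernel Q] (i j : Fin m) (R : ℝ≥0) (N : ℕ) :
    Network (fun v => (Fin N → X v) × AtNode i (Fin ⌊(N : ℝ≥0) * R⌋₊ → Bool) v)
      (fun v => (Fin N → Y v) × AtNode j (Fin ⌊(N : ℝ≥0) * R⌋₊ → Bool) v) :=
  withChannel (stack Q N) i j (bitPipe ⌊(N : ℝ≥0) * R⌋₊)

/-- The mutual information, in bits, between the input and the output of the channel `W` when the
input has law `P`. -/
noncomputable def mutualInfo {A : Type u} {B : Type v} [MeasurableSpace A] [MeasurableSpace B]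
    (P : Measure A) (W : Kernel A B) : ℝ≥0∞ :=
  InformationTheory.klDiv (P ⊗ₘ W) (P.prod (P.bind W)) / ENNReal.ofReal (Real.log 2)

/-- The capacity of the channel `W` in bits per use: the supremum of the mutual information over
all input laws. -/
noncomputable def capacity {A : Type u} {B : Type v} [MeasurableSpace A] [MeasurableSpace B]
    (W : Kernel A B) : ℝ≥0∞ :=
  ⨆ P : ProbabilityMeasure A, mutualInfo (P : Measure A) W

end NetEquiv

open NetEquiv

/-!
Let `R` be achievable when the channel `W` from `i` to `j` is replaced by a bit pipe of rate
`C = capacity W`, and let `θ < 1`. It suffices to achieve `θ • R` with `W` itself, since rate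
regions are closed (`mem_rateRegion_of_simulation`). Fix one solution `S` of blocklength `n` for the
`N`-fold stack with the pipe, whose error probabilities are small *constants*; the pipe carries
`k ≤ N C` bits per time step.

*Simulating `S`.* Run `K` copies of `S` in parallel (`blockSolution`). One time step of all the
copies together is simulated by a block of `L` uses of the network, with `K N ≤ ρ L` for some
`ρ < 1`: the copies of `Q` are `K N` of these `L` uses, and the `K k ≤ ρ L C` bits on the pipes are
sent through all `L` uses of `W` by a channel code. As `n` is fixed while `L → ∞`, it is enough that
the error probability `δ` of the channel code tends to zero: each single copy then behaves like `S`
up to `n δ` (`prob_copy_error_le`). Blocks become single network uses by `Solution.unroll`.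

*The channel code* (`exists_code_of_rate_lt_capacity`). The bits on the pipe have an unknown law, so
the error has to be small for every codeword; Feinstein's greedy argument provides this
(`exists_code_of_typical_set`), with typicality supplied by the law of large numbers for the
information density. The output alphabet need not be countably generated, so conditional densities
of `W x` are not available for almost every `x`; the argument below only uses the section integrals
of the joint density (`ae_lintegral_rnDeriv_compProd`) and the integrated inequality.

*The outer code.* Each copy of `S` still fails with constant probability. The messages are therefore
encoded across the `K` copies by a Gilbert–Varshamov code over the message alphabet of `S`
(`exists_outerCode`) that corrects a fraction `η` of wrong copies; its rate loss is small since `η`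
is small and the alphabet is large. The guarantees on `S` are averages over uniform messages, while
codewords are not uniform: a random shift makes every letter of every codeword uniform, and some
fixed shift is as good as the average one (`exists_blockSolution`). Only the expected number of
wrong copies enters, by Markov's inequality, so no joint law of the copies is needed.
-/

namespace NetEquiv

/-! ### Finite product measures -/

theorem measurable_snoc {Z : Type*} [MeasurableSpace Z] (n : ℕ) :
    Measurable fun p : (Fin n → Z) × Z => Fin.snoc (α := fun _ => Z) p.1 p.2 := by
  refine measurable_pi_lambda _ fun a => ?_
  induction a using Fin.lastCases with
  | last => simpa using measurable_snd
  | cast a => simp only [Fin.snoc_castSucc]; fun_prop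

theorem lintegral_pi_snoc {Z : Type*} [MeasurableSpace Z] {n : ℕ} (μ : Fin (n + 1) → Measure Z)
    [∀ a, SigmaFinite (μ a)] {F : (Fin (n + 1) → Z) → ℝ≥0∞} (hF : Measurable F) :
    ∫⁻ z, F z ∂Measure.pi μ =
      ∫⁻ z, ∫⁻ x, F (Fin.snoc (α := fun _ => Z) z x) ∂μ (Fin.last n)
        ∂Measure.pi fun a : Fin n => μ a.castSucc := by
  have h := (measurePreserving_piFinSuccAbove μ (Fin.last n)).symm
  have h2 : ∀ z x, F (Fin.snoc (α := fun _ => Z) z x) =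
      F ((MeasurableEquiv.piFinSuccAbove (fun _ => Z) (Fin.last n)).symm (x, z)) := by
    intro z x
    congr 1
    simp [MeasurableEquiv.piFinSuccAbove, Fin.insertNthEquiv]
  rw [← h.lintegral_comp hF]
  rw [lintegral_prod_symm' (fun a => F ((MeasurableEquiv.piFinSuccAbove (fun _ => Z)
    (Fin.last n)).symm a)) (hF.comp h.measurable)]
  simp only [h2, Fin.succAbove_last]

theorem lintegral_prod_eval_pi {ι : Type*} [Fintype ι] {Z : ι → Type*} [∀ a, MeasurableSpace (Z a)]
    (μ : ∀ a, Measure (Z a)) [∀ a, IsProbabilityMeasure (μ a)] {f : ∀ a, Z a → ℝ≥0∞}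
    (hf : ∀ a, Measurable (f a)) :
    ∫⁻ z, ∏ a, f a (z a) ∂Measure.pi μ = ∏ a, ∫⁻ x, f a x ∂μ a := by
  refine (lintegral_prod_eq_prod_lintegral_of_indepFun Finset.univ
    (fun a (z : ∀ a, Z a) => f a (z a))
    (iIndepFun_pi fun a => (hf a).aemeasurable)
    fun a => (hf a).comp (measurable_pi_apply a)).trans ?_
  exact Finset.prod_congr rfl fun a _ => (measurePreserving_eval μ a).lintegral_comp (hf a)

theorem map_pi_comp_injective {ι κ : Type*} [Fintype ι] [Fintype κ] {Z : Type*} [MeasurableSpace Z]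
    (μ : ι → Measure Z) [∀ a, IsProbabilityMeasure (μ a)] {e : κ → ι} (he : e.Injective) :
    (Measure.pi μ).map (fun z a => z (e a)) = Measure.pi fun a => μ (e a) := by
  have h : iIndepFun (fun (a : ι) (z : ι → Z) => z a) (Measure.pi μ) :=
    iIndepFun_pi (X := fun _ x => x) fun a => aemeasurable_id
  rw [(iIndepFun_iff_map_fun_eq_pi_map fun a => (measurable_pi_apply _).aemeasurable).1
    (h.precomp he)]
  congr! 2 with a
  exact (measurePreserving_eval μ (e a)).map_eq

/-! ### Coding for a single noisy channel -/

/-- **Feinstein's lemma**. Think of `E` as the jointly typical pairs: likely under the joint law,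
but with sections that are unlikely (probability at most `β`) under the output law. Codewords are
added greedily, each being decoded on the part of its section of `E` that is still unused. As long
as fewer than `card ι` sections are in use, the used part of the output space has probability less
than `card ι * β`, and integrating over the input shows that some input still works. -/
theorem exists_code_of_typical_set {A B : Type*} [MeasurableSpace A] [MeasurableSpace B]
    [Nonempty A]
    (P : Measure A) [IsProbabilityMeasure P] (V : Kernel A B) [IsMarkovKernel V]
    {E : Set (A × B)} (hE : MeasurableSet E) {β ε : ℝ≥0∞}
    (hβ : ∀ᵐ x ∂P, (V ∘ₘ P) (Prod.mk x ⁻¹' E) ≤ β)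
    {ι : Type*} [Fintype ι] [Nonempty ι] [MeasurableSpace ι] [DiscreteMeasurableSpace ι]
    (h : (P ⊗ₘ V) Eᶜ + Fintype.card ι * β < ε) :
    ∃ (enc : ι → A) (dec : B → ι), Measurable dec ∧
      ∀ c, V (enc c) {y | dec y ≠ c} ≤ ε := by
  classical
  -- `D` is the part of the output space that the decoder already assigns to the messages in `s`.
  suffices H : ∀ s : Finset ι, ∃ (enc : ι → A) (dec : B → ι) (D : Set B), Measurable dec ∧
      MeasurableSet D ∧ (V ∘ₘ P) D ≤ s.card * β ∧
      ∀ c ∈ s, V (enc c) {y | y ∈ D ∧ dec y = c}ᶜ ≤ ε by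
    obtain ⟨enc, dec, D, hdec, -, -, hc⟩ := H Finset.univ
    refine ⟨enc, dec, hdec, fun c => (measure_mono ?_).trans (hc c (Finset.mem_univ c))⟩
    exact fun y hy hy' => hy hy'.2
  intro s
  induction s using Finset.induction_on with
  | empty =>
    exact ⟨fun _ => Classical.arbitrary A, fun _ => Classical.arbitrary ι, ∅,
      measurable_const, .empty, by simp, by simp⟩
  | insert c s hcs ih =>
    obtain ⟨enc, dec, D, hdec, hD, hDβ, hs⟩ := ih
    have hsec : ∀ x, MeasurableSet (Prod.mk x ⁻¹' E) := fun x => measurable_prodMk_left hE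
    obtain ⟨x, hxβ, hx⟩ : ∃ x, (V ∘ₘ P) (Prod.mk x ⁻¹' E) ≤ β ∧
        V x (Prod.mk x ⁻¹' E \ D)ᶜ ≤ ε := by
      by_contra! hcon
      have h1 : ε ≤ (P ⊗ₘ V) (E \ Set.univ ×ˢ D)ᶜ := by
        rw [Measure.compProd_apply (hE.diff (MeasurableSet.univ.prod hD)).compl]
        calc ε = ∫⁻ _, ε ∂P := by simp
          _ ≤ _ := by
            refine lintegral_mono_ae ?_
            filter_upwards [hβ] with x hx
            refine (hcon x hx).le.trans (measure_mono fun y hy hy' => hy ?_)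
            exact ⟨hy'.1, fun h => hy'.2 ⟨trivial, h⟩⟩
      have h2 : (P ⊗ₘ V) (E \ Set.univ ×ˢ D)ᶜ ≤ (P ⊗ₘ V) Eᶜ + (V ∘ₘ P) D := by
        have h3 : (V ∘ₘ P) D = (P ⊗ₘ V) (Set.univ ×ˢ D) := by
          rw [← Measure.snd_compProd, Measure.snd_apply hD, Set.univ_prod]
        rw [h3]
        refine (measure_mono ?_).trans (measure_union_le _ _)
        intro z; simp only [Set.mem_compl_iff, Set.mem_sdiff, Set.mem_union]; tauto
      have h4 : (s.card : ℝ≥0∞) * β ≤ Fintype.card ι * β := by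
        gcongr; exact Finset.card_le_univ s
      exact absurd (h1.trans (h2.trans (add_le_add_right (hDβ.trans h4) _))) (not_le.2 h)
    refine ⟨Function.update enc c x, fun y => if y ∈ D then dec y else c, D ∪ Prod.mk x ⁻¹' E,
      Measurable.ite hD hdec measurable_const, hD.union (hsec x), ?_, ?_⟩
    · rw [Finset.card_insert_of_notMem hcs]
      push_cast
      rw [add_mul, one_mul]
      exact (measure_union_le _ _).trans (add_le_add hDβ hxβ)
    · intro c' hc'
      by_cases hcc : c' = c
      · subst hcc
        rw [Function.update_self]
        refine (measure_mono ?_).trans hx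
        intro y hy hy'
        exact hy ⟨Or.inr hy'.1, by simp [hy'.2]⟩
      · rw [Function.update_of_ne hcc]
        refine (measure_mono ?_).trans (hs c' ((Finset.mem_insert.1 hc').resolve_left hcc))
        intro y hy hy'
        exact hy ⟨Or.inl hy'.1, by simp [hy'.1, hy'.2]⟩

/-- `L` independent uses of the channel `W`. -/
noncomputable def powChannel {A B : Type*} [MeasurableSpace A] [MeasurableSpace B]
    (W : Kernel A B) [IsMarkovKernel W] (L : ℕ) : Kernel (Fin L → A) (Fin L → B) where
  toFun x := Measure.pi fun l => W (x l)
  measurable' := by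
    refine Measurable.measure_of_isPiSystem_of_isProbabilityMeasure generateFrom_pi.symm
      isPiSystem_pi ?_
    rintro _ ⟨s, hs, rfl⟩
    simp only [Measure.pi_pi]
    refine Finset.measurable_prod _ fun l _ => ?_
    exact (W.measurable_coe (hs l (Set.mem_univ l))).comp (by fun_prop)

section PowChannel

variable {A B : Type*} [MeasurableSpace A] [MeasurableSpace B] (W : Kernel A B) [IsMarkovKernel W]

theorem powChannel_apply (L : ℕ) (x : Fin L → A) :
    powChannel W L x = Measure.pi fun l => W (x l) := rfl

instance (L : ℕ) : IsMarkovKernel (powChannel W L) :=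
  ⟨fun x => by rw [powChannel_apply]; infer_instance⟩

variable (P : Measure A) [IsProbabilityMeasure P]

theorem powChannel_comp_pi (L : ℕ) :
    (powChannel W L) ∘ₘ (Measure.pi fun _ : Fin L => P) =
      Measure.pi fun _ : Fin L => W ∘ₘ P := by
  refine (Measure.pi_eq fun s hs => ?_).symm
  rw [Measure.bind_apply (.univ_pi hs) (Kernel.aemeasurable _)]
  simp only [powChannel_apply, Measure.pi_pi]
  rw [lintegral_prod_eval_pi _ fun l => W.measurable_coe (hs l)]
  exact Finset.prod_congr rfl fun l _ => (Measure.bind_apply (hs l) (Kernel.aemeasurable _)).symm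

theorem map_pi_compProd_powChannel (L : ℕ) :
    ((Measure.pi fun _ : Fin L => P) ⊗ₘ powChannel W L).map (fun p l => (p.1 l, p.2 l)) =
      Measure.pi fun _ : Fin L => P ⊗ₘ W := by
  refine (Measure.pi_eq fun s hs => ?_).symm
  have hm : Measurable fun (p : (Fin L → A) × (Fin L → B)) l => (p.1 l, p.2 l) := by fun_prop
  rw [Measure.map_apply hm (.univ_pi hs), Measure.compProd_apply (hm (.univ_pi hs))]
  have h : ∀ x : Fin L → A, powChannel W L x (Prod.mk x ⁻¹'
      ((fun (p : (Fin L → A) × (Fin L → B)) l => (p.1 l, p.2 l)) ⁻¹' Set.univ.pi s)) =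
      ∏ l, W (x l) (Prod.mk (x l) ⁻¹' s l) := by
    intro x
    rw [powChannel_apply, ← Measure.pi_pi]
    rfl
  simp only [h]
  rw [lintegral_prod_eval_pi _ fun l => Kernel.measurable_kernel_prodMk_left (hs l)]
  exact Finset.prod_congr rfl fun l _ => (Measure.compProd_apply (hs l)).symm

end PowChannel

/-- The weak law of large numbers for finite product measures. Only integrability is assumed, as the
information density need not have a finite variance. -/
theorem tendsto_pi_sum_le {Ω : Type*} [MeasurableSpace Ω] (μ : Measure Ω) [IsProbabilityMeasure μ]
    {g : Ω → ℝ} (hg : Measurable g) (hi : Integrable g μ) {c : ℝ} (hc : c < ∫ z, g z ∂μ) :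
    Tendsto (fun L : ℕ => (Measure.pi fun _ : Fin L => μ) {z | ∑ l, g (z l) ≤ L * c}) atTop
      (nhds 0) := by
  set ν := Measure.infinitePi fun _ : ℕ => μ with hν
  have hmp : ∀ a : ℕ, MeasurePreserving (fun ω : ℕ → Ω => ω a) ν μ := fun a =>
    measurePreserving_eval_infinitePi (fun _ => μ) a
  have hind : iIndepFun (fun (a : ℕ) (ω : ℕ → Ω) => g (ω a)) ν :=
    iIndepFun_infinitePi (X := fun _ => g) fun _ => hg
  have hind' : iIndepFun (fun (a : ℕ) (ω : ℕ → Ω) => ω a) ν :=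
    iIndepFun_infinitePi (X := fun _ => id) fun _ => measurable_id
  have hid : ∀ a : ℕ, IdentDistrib (fun ω : ℕ → Ω => g (ω a)) (fun ω => g (ω 0)) ν ν := fun a =>
    (IdentDistrib.mk (hmp a).aemeasurable (hmp 0).aemeasurable
      ((hmp a).map_eq.trans (hmp 0).map_eq.symm)).comp hg
  have hint : ∫ ω, g (ω 0) ∂ν = ∫ z, g z ∂μ := by
    rw [← (hmp 0).map_eq, integral_map (hmp 0).aemeasurable hg.aestronglyMeasurable]
  have hslln := strong_law_ae_real (μ := ν) (fun a ω => g (ω a))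
    ((hmp 0).integrable_comp_of_integrable hi) (fun a b hab => hind.indepFun hab) hid
  rw [hint] at hslln
  have hprob := tendstoInMeasure_of_tendsto_ae (fun L => by
    have : Measurable fun ω : ℕ → Ω => (∑ a ∈ Finset.range L, g (ω a)) / (L : ℝ) := by fun_prop
    exact this.aestronglyMeasurable) hslln
  have hε : 0 < ENNReal.ofReal (∫ z, g z ∂μ - c) := by simpa using hc
  refine tendsto_of_tendsto_of_tendsto_of_le_of_le' tendsto_const_nhds (hprob _ hε)
    (.of_forall fun _ => zero_le) ?_
  filter_upwards [eventually_gt_atTop 0] with L hL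
  have hmap : Measure.pi (fun _ : Fin L => μ) = ν.map fun ω (a : Fin L) => ω a := by
    rw [(iIndepFun_iff_map_fun_eq_pi_map fun a => (measurable_pi_apply _).aemeasurable).1
      (hind'.precomp Fin.val_injective)]
    congr! 2 with a
    exact (hmp a).map_eq.symm
  rw [hmap, Measure.map_apply (by fun_prop) (measurableSet_le (by fun_prop) (by fun_prop))]
  refine measure_mono fun ω hω => ?_
  simp only [Set.mem_preimage, Set.mem_ofPred_eq] at hω ⊢
  rw [edist_dist, Real.dist_eq]
  refine ENNReal.ofReal_le_ofReal ?_
  rw [Fin.sum_univ_eq_sum_range (fun a => g (ω a))] at hω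
  have hL' : (0 : ℝ) < L := by exact_mod_cast hL
  have : (∑ a ∈ Finset.range L, g (ω a)) / (L : ℝ) ≤ c := by
    rw [div_le_iff₀ hL']; linarith
  rw [abs_sub_comm]
  exact (by linarith : _ ≤ _).trans (le_abs_self _)

/-- For almost every input `x`, the section at `x` of the joint density is a probability density
for the output law. (Whether this density is that of `W x` may depend on `B` being countably
generated, and is not claimed.) -/
theorem ae_lintegral_rnDeriv_compProd {A B : Type*} [MeasurableSpace A] [MeasurableSpace B]
    (P : Measure A) [IsProbabilityMeasure P] (W : Kernel A B) [IsMarkovKernel W]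
    (h : P ⊗ₘ W ≪ P.prod (W ∘ₘ P)) :
    ∀ᵐ x ∂P, ∫⁻ y, (P ⊗ₘ W).rnDeriv (P.prod (W ∘ₘ P)) (x, y) ∂(W ∘ₘ P) = 1 := by
  have hm := Measure.measurable_rnDeriv (P ⊗ₘ W) (P.prod (W ∘ₘ P))
  refine ae_eq_of_forall_setLIntegral_eq_of_sigmaFinite hm.lintegral_prod_right'
    measurable_const fun s hs _ => ?_
  have h1 : (P ⊗ₘ W) (s ×ˢ Set.univ) = P s := by
    rw [Set.prod_univ, ← Measure.fst_apply hs, Measure.fst_compProd]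
  rw [setLIntegral_one, ← h1, ← Measure.setLIntegral_rnDeriv h, ← Measure.prod_restrict,
    Measure.restrict_univ, lintegral_prod _ hm.aemeasurable]

/-- **The noisy-channel coding theorem** for maximal error and arbitrary alphabets: at rates
`ρ * C < C`, long codes have error probability at most `δ` for every codeword. For `C = 0` there is
only one message. -/
theorem exists_code_of_rate_lt_capacity {A B : Type*} [MeasurableSpace A] [MeasurableSpace B]
    [Nonempty A] (W : Kernel A B) [IsMarkovKernel W] {C : ℝ≥0} (hC : capacity W = C) {ρ : ℝ}
    (hρ : ρ < 1) {δ : ℝ≥0∞} (hδ : 0 < δ) :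
    ∀ᶠ L : ℕ in atTop, ∀ (ι : Type) [Fintype ι] [Nonempty ι] [MeasurableSpace ι]
      [DiscreteMeasurableSpace ι], (Fintype.card ι : ℝ) ≤ 2 ^ (ρ * L * C) →
      ∃ (enc : ι → Fin L → A) (dec : (Fin L → B) → ι), Measurable dec ∧
        ∀ c, powChannel W L (enc c) {y | dec y ≠ c} ≤ δ := by
  rcases eq_or_ne C 0 with rfl | hC0
  · refine .of_forall fun L ι _ _ _ _ hcard => ?_
    have : Subsingleton ι := by
      rw [← Fintype.card_le_one_iff_subsingleton]
      simpa using hcard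
    refine ⟨fun _ _ => Classical.arbitrary A, fun _ => Classical.arbitrary ι, measurable_const,
      fun c => ?_⟩
    have : {y : Fin L → B | Classical.arbitrary ι ≠ c} = ∅ := by
      ext y; simp [Subsingleton.elim (Classical.arbitrary ι) c]
    rw [this]; simp
  have hCpos : 0 < (C : ℝ) := by positivity
  obtain ⟨P, hP⟩ : ∃ P : ProbabilityMeasure A,
      ENNReal.ofReal (ρ * C) < mutualInfo (P : Measure A) W := by
    rw [← lt_iSup_iff]
    change _ < capacity W
    rw [hC, ← ENNReal.ofReal_coe_nnreal]
    exact (ENNReal.ofReal_lt_ofReal_iff hCpos).2 (by nlinarith)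
  have hle : mutualInfo (P : Measure A) W ≤ C := hC ▸ le_iSup
    (fun P : ProbabilityMeasure A => mutualInfo (P : Measure A) W) P
  set μ := (P : Measure A) ⊗ₘ W with hμ
  set q := W ∘ₘ (P : Measure A) with hq
  set f := μ.rnDeriv ((P : Measure A).prod q) with hf
  have hlog : 0 < Real.log 2 := Real.log_pos (by norm_num)
  have hkl : InformationTheory.klDiv μ ((P : Measure A).prod q) ≠ ∞ := by
    intro h
    have h2 : mutualInfo (P : Measure A) W = ∞ := by
      change InformationTheory.klDiv μ ((P : Measure A).prod q) / _ = _
      rw [h, ENNReal.top_div_of_ne_top ENNReal.ofReal_ne_top]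
    rw [h2] at hle
    exact absurd hle (by simp)
  obtain ⟨hac, hint⟩ := InformationTheory.klDiv_ne_top_iff.1 hkl
  have hI := InformationTheory.toReal_klDiv_of_measure_eq hac (by simp)
  have hgap : ρ * C * Real.log 2 < ∫ z, llr μ ((P : Measure A).prod q) z ∂μ := by
    rw [← hI, ← lt_div_iff₀ hlog]
    have h1 : mutualInfo (P : Measure A) W = ENNReal.ofReal
        ((InformationTheory.klDiv μ ((P : Measure A).prod q)).toReal / Real.log 2) := by
      rw [ENNReal.ofReal_div_of_pos hlog, ENNReal.ofReal_toReal hkl]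
      rfl
    rw [h1] at hP
    exact (ENNReal.ofReal_lt_ofReal_iff').1 hP |>.1
  -- The typicality threshold `c` (in nats) lies between the rate and the mutual information.
  obtain ⟨c, hc1, hc2⟩ := exists_between hgap
  have hfm : Measurable f := Measure.measurable_rnDeriv _ _
  have hlm : Measurable (llr μ ((P : Measure A).prod q)) := measurable_llr _ _
  have hlln := tendsto_pi_sum_le μ hlm hint hc2
  have hexp : Tendsto (fun L : ℕ => ENNReal.ofReal (Real.exp (-(c - ρ * C * Real.log 2) * L)))
      atTop (nhds 0) := by
    rw [← ENNReal.ofReal_zero]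
    refine ENNReal.tendsto_ofReal (Real.tendsto_exp_atBot.comp ?_)
    exact tendsto_natCast_atTop_atTop.const_mul_atTop_of_neg (by linarith)
  have hsum := hlln.add hexp
  rw [add_zero] at hsum
  filter_upwards [hsum.eventually_lt_const hδ] with L hL ι _ _ _ _ hcard
  have hzip : Measurable fun (p : (Fin L → A) × (Fin L → B)) l => (p.1 l, p.2 l) := by fun_prop
  -- `llr` involves the logarithm of a real number, which is junk where `f` is `0` or `∞`.
  set F : Set (Fin L → A × B) := {z | (∀ l, 0 < f (z l) ∧ f (z l) < ∞) ∧
    L * c < ∑ l, llr μ ((P : Measure A).prod q) (z l)} with hF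
  have hFm : MeasurableSet F := by
    have h1 : MeasurableSet {z : Fin L → A × B | ∀ l, 0 < f (z l) ∧ f (z l) < ∞} := by
      rw [show {z : Fin L → A × B | ∀ l, 0 < f (z l) ∧ f (z l) < ∞} =
        ⋂ l, {z | 0 < f (z l)} ∩ {z | f (z l) < ∞} by ext z; simp]
      exact .iInter fun l =>
        (measurableSet_lt measurable_const (hfm.comp (measurable_pi_apply l))).inter
          (measurableSet_lt (hfm.comp (measurable_pi_apply l)) measurable_const)
    exact h1.inter (measurableSet_lt measurable_const
      (Finset.measurable_sum _ fun l _ => hlm.comp (measurable_pi_apply l)))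
  refine exists_code_of_typical_set (Measure.pi fun _ : Fin L => (P : Measure A)) (powChannel W L)
    (E := (fun p l => (p.1 l, p.2 l)) ⁻¹' F) (hzip hFm)
    (β := ENNReal.ofReal (Real.exp (-(L * c)))) ?_ ?_
  · have hae : ∀ᵐ x ∂(Measure.pi fun _ : Fin L => (P : Measure A)),
        ∀ l, ∫⁻ y, f (x l, y) ∂q = 1 :=
      ae_all_iff.2 fun l =>
        (Measure.tendsto_eval_ae_ae (μ := fun _ : Fin L => (P : Measure A)) (i := l)).eventually
          (ae_lintegral_rnDeriv_compProd (P : Measure A) W hac)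
    filter_upwards [hae] with x hx
    rw [powChannel_comp_pi]
    have hsub : Prod.mk x ⁻¹' ((fun (p : (Fin L → A) × (Fin L → B)) l => (p.1 l, p.2 l)) ⁻¹' F) ⊆
        {y | ENNReal.ofReal (Real.exp (L * c)) ≤ ∏ l, f (x l, y l)} := by
      intro y hy
      obtain ⟨h1, h2⟩ := hy
      have h3 : ∏ l, f (x l, y l) = ENNReal.ofReal (Real.exp
          (∑ l, llr μ ((P : Measure A).prod q) (x l, y l))) := by
        rw [Real.exp_sum, ENNReal.ofReal_prod_of_nonneg fun _ _ => (Real.exp_pos _).le]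
        refine Finset.prod_congr rfl fun l _ => ?_
        rw [llr, Real.exp_log (ENNReal.toReal_pos (h1 l).1.ne' (h1 l).2.ne),
          ENNReal.ofReal_toReal (h1 l).2.ne]
      simp only [Set.mem_ofPred_eq]
      rw [h3]
      exact ENNReal.ofReal_le_ofReal (Real.exp_le_exp.2 h2.le)
    refine (measure_mono hsub).trans ?_
    have hmk := meas_ge_le_lintegral_div (μ := Measure.pi fun _ : Fin L => q)
      (f := fun y => ∏ l, f (x l, y l)) (by
        refine (Finset.measurable_prod _ fun l _ => ?_).aemeasurable
        exact hfm.comp (by fun_prop)) (ε := ENNReal.ofReal (Real.exp (L * c)))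
        (by simpa using Real.exp_pos _) ENNReal.ofReal_ne_top
    rw [lintegral_prod_eval_pi (fun _ => q) (f := fun l y => f (x l, y))
      fun l => hfm.comp (by fun_prop)] at hmk
    refine hmk.trans ?_
    simp only [hx, Finset.prod_const_one]
    rw [Real.exp_neg, ENNReal.ofReal_inv_of_pos (Real.exp_pos _), one_div]
  · refine lt_of_le_of_lt (add_le_add ?_ ?_) hL
    · rw [← Set.preimage_compl, ← Measure.map_apply hzip hFm.compl, map_pi_compProd_powChannel]
      refine measure_mono_ae ?_
      have hae : ∀ᵐ z ∂μ, 0 < f z ∧ f z < ∞ := by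
        filter_upwards [Measure.rnDeriv_pos hac, hac.ae_le (Measure.rnDeriv_lt_top μ _)]
          with z h1 h2
        exact ⟨h1, h2⟩
      have hae' : ∀ᵐ z ∂(Measure.pi fun _ : Fin L => μ), ∀ l, 0 < f (z l) ∧ f (z l) < ∞ :=
        ae_all_iff.2 fun l =>
          (Measure.tendsto_eval_ae_ae (μ := fun _ : Fin L => μ) (i := l)).eventually hae
      filter_upwards [hae'] with z hz hz'
      by_contra hcon
      exact hz' ⟨hz, not_le.1 hcon⟩
    · rw [← ENNReal.ofReal_natCast, ← ENNReal.ofReal_mul (by positivity)]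
      refine ENNReal.ofReal_le_ofReal ?_
      calc (Fintype.card ι : ℝ) * Real.exp (-(L * c))
          ≤ 2 ^ (ρ * L * C) * Real.exp (-(L * c)) := by gcongr
        _ = _ := by
          rw [Real.rpow_def_of_pos (by norm_num), ← Real.exp_add]
          congr 1; ring

/-! ### Comparing solutions -/

theorem measurable_snoc_right {Z : Type*} [MeasurableSpace Z] {n : ℕ} (y : Fin n → Z) :
    Measurable fun z => Fin.snoc (α := fun _ => Z) y z :=
  (measurable_snoc n).comp measurable_prodMk_left

theorem measurable_append_right {Z : Type*} [MeasurableSpace Z] {b p : ℕ} (y : Fin b → Z) :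
    Measurable fun z : Fin p → Z => Fin.append y z := by
  refine measurable_pi_lambda _ fun a => ?_
  induction a using Fin.addCases with
  | left a => simp
  | right a => simpa using measurable_pi_apply a

theorem measurable_layers {m : ℕ} {Y : Fin m → Type*} [∀ v, MeasurableSpace (Y v)] (L : ℕ) :
    Measurable fun (z : Fin L → ∀ v, Y v) v l => z l v :=
  measurable_pi_lambda _ fun v => measurable_pi_lambda _ fun l =>
    (measurable_pi_apply v).comp (measurable_pi_apply l)

namespace Solution

variable {m : ℕ} {X Y : Fin m → Type*}
  [∀ v, MeasurableSpace (X v)] [∀ v, MeasurableSpace (Y v)]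
  {M : Fin m → Fin m → Type} {n : ℕ}

theorem lintegral_outputLaw_succ (S : Solution X Y M n) (K : Network X Y) [IsMarkovKernel K]
    (w : ∀ u v, M u v) {t : ℕ} (h : t + 1 ≤ n) [SFinite (S.outputLaw K w t (Nat.le_of_succ_le h))]
    {F : (Fin (t + 1) → ∀ v, Y v) → ℝ≥0∞} (hF : Measurable F) :
    ∫⁻ y, F y ∂S.outputLaw K w (t + 1) h =
      ∫⁻ y, ∫⁻ z, F (Fin.snoc (α := fun _ => ∀ v, Y v) y z) ∂K (S.inputs w ⟨t, h⟩ y)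
        ∂S.outputLaw K w t (Nat.le_of_succ_le h) := by
  rw [outputLaw, lintegral_map hF (measurable_snoc t),
    Measure.lintegral_compProd (hF.fun_comp (measurable_snoc t))]
  rfl

instance isProbabilityMeasure_outputLaw (S : Solution X Y M n) (K : Network X Y)
    [IsMarkovKernel K] (w : ∀ u v, M u v) (t : ℕ) (h : t ≤ n) :
    IsProbabilityMeasure (S.outputLaw K w t h) := by
  induction t with
  | zero => rw [outputLaw]; infer_instance
  | succ t ih =>
    have := ih (Nat.le_of_succ_le h)
    rw [outputLaw]
    exact Measure.isProbabilityMeasure_map (measurable_snoc t).aemeasurable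

theorem measurable_lintegral_inputs (S : Solution X Y M n) (K : Network X Y) [IsMarkovKernel K]
    (w : ∀ u v, M u v) (t : Fin n) {F : (Fin (t + 1) → ∀ v, Y v) → ℝ≥0∞} (hF : Measurable F) :
    Measurable fun y => ∫⁻ z, F (Fin.snoc (α := fun _ => ∀ v, Y v) y z) ∂K (S.inputs w t y) :=
  Measurable.lintegral_kernel_prod_right' (κ := K.comap _ (S.measurable_inputs w t))
    (hF.comp (measurable_snoc _))

/-- If, whatever the past, each time step of `S'` on `K'`, seen through `g`, is within `δ` in total
variation of the corresponding time step of `S` on `K`, then the outputs of `t` steps are within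
`t * δ`. Total variation is expressed by test functions with values in `[0, 1]`, which makes the
induction immediate. -/
theorem lintegral_outputLaw_le {X' Y' : Fin m → Type*}
    [∀ v, MeasurableSpace (X' v)] [∀ v, MeasurableSpace (Y' v)] {M' : Fin m → Fin m → Type}
    (S : Solution X Y M n) (S' : Solution X' Y' M' n) (K : Network X Y) (K' : Network X' Y')
    [IsMarkovKernel K] [IsMarkovKernel K'] (w : ∀ u v, M u v) (w' : ∀ u v, M' u v)
    {g : (∀ v, Y' v) → ∀ v, Y v} (hg : Measurable g) {δ : ℝ≥0∞}
    (h : ∀ (t : Fin n) (y : Fin t → ∀ v, Y' v) (H : (∀ v, Y v) → ℝ≥0∞), Measurable H →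
      (∀ z, H z ≤ 1) → ∫⁻ z, H (g z) ∂K' (S'.inputs w' t y) ≤
        ∫⁻ z, H z ∂K (S.inputs w t fun s => g (y s)) + δ) (t : ℕ) (ht : t ≤ n)
    {H : (Fin t → ∀ v, Y v) → ℝ≥0∞} (hH : Measurable H) (hH1 : ∀ y, H y ≤ 1) :
    ∫⁻ y, H (fun s => g (y s)) ∂S'.outputLaw K' w' t ht ≤
      ∫⁻ y, H y ∂S.outputLaw K w t ht + t * δ := by
  induction t with
  | zero =>
    simp only [outputLaw, CharP.cast_eq_zero, zero_mul, add_zero]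
    rw [lintegral_dirac' _ (hH.fun_comp (by fun_prop)), lintegral_dirac' _ hH]
    exact (congrArg H (Subsingleton.elim _ _)).le
  | succ t ih =>
    rw [lintegral_outputLaw_succ _ _ _ _ hH,
      lintegral_outputLaw_succ _ _ _ _ (F := fun y => H fun s => g (y s))
        (hH.fun_comp (by fun_prop))]
    have hs : ∀ (y : Fin t → ∀ v, Y' v) (z : ∀ v, Y' v),
        (fun s => g (Fin.snoc (α := fun _ => ∀ v, Y' v) y z s)) =
          Fin.snoc (α := fun _ => ∀ v, Y v) (fun s => g (y s)) (g z) := fun y z =>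
      Fin.comp_snoc g y z
    simp only [hs]
    calc _ ≤ ∫⁻ y, (∫⁻ z, H (Fin.snoc (α := fun _ => ∀ v, Y v) (fun s => g (y s)) z)
            ∂K (S.inputs w ⟨t, ht⟩ fun s => g (y s)) + δ)
            ∂S'.outputLaw K' w' t (Nat.le_of_succ_le ht) := by
          refine lintegral_mono fun y => ?_
          exact h ⟨t, ht⟩ y _ (hH.fun_comp (measurable_snoc_right _))
            fun z => hH1 _
      _ = ∫⁻ y, ∫⁻ z, H (Fin.snoc (α := fun _ => ∀ v, Y v) (fun s => g (y s)) z)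
            ∂K (S.inputs w ⟨t, ht⟩ fun s => g (y s))
            ∂S'.outputLaw K' w' t (Nat.le_of_succ_le ht) + δ := by
          rw [lintegral_add_right _ measurable_const]; simp
      _ ≤ _ := by
          refine (add_le_add_left (ih (Nat.le_of_succ_le ht)
            (S.measurable_lintegral_inputs K w ⟨t, ht⟩ hH) fun y => ?_) δ).trans_eq ?_
          · refine (lintegral_mono (g := fun _ => 1) fun z => hH1 _).trans ?_
            simp
          · push_cast; ring

/-- The law of the first `t` outputs is not affected by later time steps. -/
theorem lintegral_outputLaw_castLE (S : Solution X Y M n) (K : Network X Y) [IsMarkovKernel K]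
    (w : ∀ u v, M u v) {t t' : ℕ} (h : t ≤ t') (h' : t' ≤ n)
    {F : (Fin t → ∀ v, Y v) → ℝ≥0∞} (hF : Measurable F) :
    ∫⁻ y, F (fun s => y (s.castLE h)) ∂S.outputLaw K w t' h' =
      ∫⁻ y, F y ∂S.outputLaw K w t (h.trans h') := by
  induction t', h using Nat.le_induction with
  | base => rfl
  | succ t' h ih =>
    rw [lintegral_outputLaw_succ _ _ _ _
      (F := fun y => F fun s => y (s.castLE (h.trans t'.le_succ)))
      (hF.fun_comp (by fun_prop)), ← ih (Nat.le_of_succ_le h')]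
    refine lintegral_congr fun y => ?_
    have : ∀ z, (fun s : Fin t => Fin.snoc (α := fun _ => ∀ v, Y v) y z
        (s.castLE (h.trans t'.le_succ))) = fun s => y (s.castLE h) := by
      intro z
      ext1 s
      exact Fin.snoc_castSucc (α := fun _ => ∀ v, Y v) z y (s.castLE h)
    simp only [this]
    simp

/-! ### Unrolling a stack in time -/

/-- The first `b` blocks of length `L` of a sequence of length `T`. -/
def block {Z : Type*} {L b T : ℕ} (h : L * b ≤ T) (y : Fin T → Z) : Fin b → Fin L → Z :=
  fun s a => y ⟨L * s + a, by
    have h1 : L * (s + 1) ≤ L * b := Nat.mul_le_mul_left L s.2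
    have h3 := a.2
    rw [Nat.mul_add] at h1
    lia⟩

/-- A solution of the `L`-fold stack, run on `n'` uses of a single network: one use of the stack
becomes a block of `L` consecutive uses. Encoders in a block see only the outputs of earlier blocks;
the constant `x₀` is sent in the time that remains after `n` blocks. -/
def unroll {L : ℕ} (hL : 0 < L) (S : Solution (fun v => Fin L → X v) (fun v => Fin L → Y v) M n)
    (x₀ : ∀ v, X v) (n' : ℕ) (h : L * n ≤ n') : Solution X Y M n' where
  enc t v y w := if ht : (t : ℕ) / L < n then
    S.enc ⟨t / L, ht⟩ v (block (Nat.mul_div_le _ _) y) w ⟨t % L, Nat.mod_lt _ hL⟩ else x₀ v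
  dec u v y w := S.dec u v (block h y) w
  measurable_enc t v w := by
    split_ifs with ht
    · exact (measurable_pi_apply _).fun_comp ((S.measurable_enc _ v w).comp
        (measurable_pi_lambda _ fun s => measurable_pi_lambda _ fun a => measurable_pi_apply _))
    · exact measurable_const
  measurable_dec u v w w' := by
    have : Measurable (block (Z := Y v) h) :=
      measurable_pi_lambda _ fun s => measurable_pi_lambda _ fun a => measurable_pi_apply _
    exact this (S.measurable_dec u v w w')

theorem lintegral_stack (K : Network X Y) [IsMarkovKernel K] (L : ℕ) (x : ∀ v, Fin L → X v)
    {F : (∀ v, Fin L → Y v) → ℝ≥0∞} (hF : Measurable F) :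
    ∫⁻ y, F y ∂stack K L x =
      ∫⁻ z, F (fun v l => z l v) ∂Measure.pi fun l : Fin L => K fun v => x v l :=
  lintegral_map hF (measurable_layers L)

instance (K : Network X Y) [IsMarkovKernel K] (L : ℕ) : IsMarkovKernel (stack K L) :=
  ⟨fun _ => Measure.isProbabilityMeasure_map (measurable_layers L).aemeasurable⟩

theorem measurable_block_layers (L b : ℕ) :
    Measurable fun (y : Fin (L * b) → ∀ v, Y v) (s : Fin b) v (l : Fin L) =>
      block le_rfl y s l v :=
  measurable_pi_lambda _ fun _ => measurable_pi_lambda _ fun v =>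
    measurable_pi_lambda _ fun _ => (measurable_pi_apply v).comp (measurable_pi_apply _)

/-- Given the first `b` blocks, the inputs in the next block do not depend on the outputs in it, so
the first `p` outputs in that block are independent. -/
theorem lintegral_unroll_append {L : ℕ} (hL : 0 < L)
    (S : Solution (fun v => Fin L → X v) (fun v => Fin L → Y v) M n) (x₀ : ∀ v, X v) (n' : ℕ)
    (h : L * n ≤ n') (K : Network X Y) [IsMarkovKernel K] (w : ∀ u v, M u v) {b : ℕ} (hb : b < n)
    {p : ℕ} (hp : p ≤ L) (hT : L * b + p ≤ n') {F : (Fin (L * b + p) → ∀ v, Y v) → ℝ≥0∞}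
    (hF : Measurable F) :
    ∫⁻ y, F y ∂(S.unroll hL x₀ n' h).outputLaw K w (L * b + p) hT =
      ∫⁻ y, ∫⁻ z, F (Fin.append y z)
        ∂(Measure.pi fun a : Fin p => K fun v =>
          S.inputs w ⟨b, hb⟩ (fun s v l => block le_rfl y s l v) v (a.castLE hp))
        ∂(S.unroll hL x₀ n' h).outputLaw K w (L * b) ((Nat.le_add_right _ _).trans hT) := by
  induction p with
  | zero =>
    refine lintegral_congr fun y => ?_
    rw [lintegral_unique]
    simp [Subsingleton.elim (default : Fin 0 → ∀ v, Y v) Fin.elim0]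
  | succ p ih =>
    have h1 := (S.unroll hL x₀ n' h).lintegral_outputLaw_succ K w (t := L * b + p) hT hF
    refine h1.trans ?_
    rw [ih (Nat.le_of_succ_le hp) (Nat.le_of_succ_le hT)
      ((S.unroll hL x₀ n' h).measurable_lintegral_inputs K w ⟨L * b + p, hT⟩ hF)]
    refine lintegral_congr fun y => ?_
    rw [lintegral_pi_snoc _ (hF.fun_comp (measurable_append_right y))]
    refine lintegral_congr fun z => ?_
    have hp' : p < L := hp
    have hdiv : (L * b + p) / L = b := by
      rw [Nat.mul_add_div hL, Nat.div_eq_of_lt hp', add_zero]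
    have hmod : (L * b + p) % L = p := by rw [Nat.mul_add_mod, Nat.mod_eq_of_lt hp']
    have h2 : (S.unroll hL x₀ n' h).inputs w ⟨L * b + p, hT⟩ (Fin.append y z) = fun v =>
        S.inputs w ⟨b, hb⟩ (fun s v l => block le_rfl y s l v) v ((Fin.last p).castLE hp) := by
      ext v
      have hcongr : ∀ (c : ℕ) (hc : c = b) (hcn : c < n) (r : Fin L) (hr : (r : ℕ) = p)
          (y' : Fin c → Fin L → Y v),
          (∀ s l, y' s l = block le_rfl y ⟨s, hc ▸ s.2⟩ l v) →
          S.enc ⟨c, hcn⟩ v y' (w v) r =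
            S.inputs w ⟨b, hb⟩ (fun s v l => block le_rfl y s l v) v ((Fin.last p).castLE hp) := by
        rintro c rfl hcn r hr y' hy'
        obtain rfl : r = (Fin.last p).castLE hp := Fin.ext hr
        obtain rfl : y' = fun s l => block le_rfl y s l v := funext₂ hy'
        rfl
      refine (dif_pos (hdiv.trans_lt hb)).trans (hcongr _ hdiv _ _ hmod _ fun s l => ?_)
      have hs : L * (s : ℕ) + l < L * b := by
        have h3 : (s : ℕ) < b := s.2.trans_eq hdiv
        have h4 : L * (s + 1) ≤ L * b := Nat.mul_le_mul_left L h3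
        have h5 := l.2
        rw [Nat.mul_add] at h4
        lia
      exact congrFun (Fin.append_left y z ⟨L * s + l, hs⟩) v
    rw [h2]
    refine lintegral_congr fun x => ?_
    rw [Fin.append_snoc]

/-- Grouped into blocks, the outputs of the unrolled solution have the law of the outputs of the
solution of the stack. -/
theorem lintegral_unroll_block {L : ℕ} (hL : 0 < L)
    (S : Solution (fun v => Fin L → X v) (fun v => Fin L → Y v) M n) (x₀ : ∀ v, X v) (n' : ℕ)
    (h : L * n ≤ n') (K : Network X Y) [IsMarkovKernel K] (w : ∀ u v, M u v) {b : ℕ} (hb : b ≤ n)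
    {F : (Fin b → ∀ v, Fin L → Y v) → ℝ≥0∞} (hF : Measurable F) :
    ∫⁻ y, F (fun s v l => block le_rfl y s l v)
        ∂(S.unroll hL x₀ n' h).outputLaw K w (L * b) ((Nat.mul_le_mul_left L hb).trans h) =
      ∫⁻ y, F y ∂S.outputLaw (stack K L) w b hb := by
  induction b with
  | zero =>
    change ∫⁻ y, _ ∂Measure.dirac _ = ∫⁻ y, _ ∂Measure.dirac _
    rw [lintegral_dirac' _ (hF.fun_comp (measurable_block_layers L 0)), lintegral_dirac' _ hF]
    exact congrArg F (Subsingleton.elim _ _)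
  | succ b ih =>
    refine (lintegral_unroll_append hL S x₀ n' h K w hb le_rfl
      ((Nat.mul_le_mul_left L hb).trans h)
      (hF.fun_comp (measurable_block_layers L (b + 1)))).trans ?_
    rw [lintegral_outputLaw_succ _ _ _ _ hF,
      ← ih (Nat.le_of_succ_le hb) (S.measurable_lintegral_inputs (stack K L) w ⟨b, hb⟩ hF)]
    refine lintegral_congr fun y => ?_
    rw [lintegral_stack _ _ _ (hF.fun_comp ((measurable_snoc b).fun_comp measurable_prodMk_left))]
    refine lintegral_congr fun z => ?_
    congr 1
    ext s v l
    induction s using Fin.lastCases with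
    | last =>
      rw [Fin.snoc_last]
      exact congrFun (Fin.append_right y z l) v
    | cast s =>
      rw [Fin.snoc_castSucc]
      have hs : L * (s : ℕ) + l < L * b := by
        have h4 : L * (s + 1) ≤ L * b := Nat.mul_le_mul_left L s.2
        have h5 := l.2
        rw [Nat.mul_add] at h4
        lia
      exact congrFun (Fin.append_left y z ⟨L * s + l, hs⟩) v

theorem errorProb_unroll {L : ℕ} (hL : 0 < L) [∀ u v, Fintype (M u v)]
    (S : Solution (fun v => Fin L → X v) (fun v => Fin L → Y v) M n) (x₀ : ∀ v, X v) (n' : ℕ)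
    (h : L * n ≤ n') (K : Network X Y) [IsMarkovKernel K] (u v : Fin m) :
    (S.unroll hL x₀ n' h).errorProb K u v = S.errorProb (stack K L) u v := by
  unfold errorProb
  congr 1
  refine Finset.sum_congr rfl fun w _ => ?_
  have hE : MeasurableSet {y : Fin n → ∀ v, Fin L → Y v |
      S.dec u v (fun t => y t v) (w v) ≠ w u v} := by
    have : Measurable fun (y : Fin n → ∀ v, Fin L → Y v) t => y t v := by fun_prop
    exact this (S.measurable_dec u v (w v) (w u v)).compl
  have h1 := lintegral_unroll_block hL S x₀ n' h K w le_rfl (measurable_one.indicator hE)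
  rw [lintegral_indicator_one hE, ← (S.unroll hL x₀ n' h).lintegral_outputLaw_castLE K w h le_rfl
    ((measurable_one.indicator hE).fun_comp (measurable_block_layers L n))] at h1
  rw [Measure.real, Measure.real, ← h1]
  congr 1
  rw [← lintegral_indicator_one]
  · rfl
  · exact ((S.unroll hL x₀ n' h).measurable_dec u v (w v) (w u v)).compl.preimage
      (by fun_prop : Measurable fun (y : Fin n' → ∀ v, Y v) t => y t v)

end Solution

/-! ### Parallel copies over a noisy channel -/

section Marginals

variable {m : ℕ} {X Y : Fin m → Type*} [∀ v, MeasurableSpace (X v)] [∀ v, MeasurableSpace (Y v)]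
  {A B : Type*} [MeasurableSpace A] [MeasurableSpace B]

instance (Q : Network X Y) [IsMarkovKernel Q] (i j : Fin m) (W : Kernel A B) [IsMarkovKernel W] :
    IsMarkovKernel (withChannel Q i j W) :=
  Kernel.IsMarkovKernel.map _ (by fun_prop)

instance (k : ℕ) : IsMarkovKernel (bitPipe k) :=
  inferInstanceAs (IsMarkovKernel Kernel.id)

theorem withChannel_apply (Q : Network X Y) [IsMarkovKernel Q] (i j : Fin m) (W : Kernel A B)
    [IsMarkovKernel W] (x : ∀ v, X v × AtNode i A v) :
    withChannel Q i j W x = ((Q fun v => (x v).1).prod (W ((x i).2 ⟨rfl⟩))).map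
      fun p v => (p.1 v, fun _ => p.2) := by
  rw [withChannel, Kernel.map_apply _ (by fun_prop), Kernel.comap_apply, Kernel.parallelComp_apply]

theorem lintegral_withChannel_bitPipe (Q : Network X Y) [IsMarkovKernel Q] (i j : Fin m) (k : ℕ)
    (x : ∀ v, X v × AtNode i (Fin k → Bool) v)
    {H : (∀ v, Y v × AtNode j (Fin k → Bool) v) → ℝ≥0∞} (hH : Measurable H) :
    ∫⁻ y, H y ∂withChannel Q i j (bitPipe k) x =
      ∫⁻ y, H (fun v => (y v, fun _ => (x i).2 ⟨rfl⟩)) ∂Q fun v => (x v).1 := by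
  rw [withChannel_apply, lintegral_map hH (by fun_prop), bitPipe, Kernel.id_apply,
    Measure.prod_dirac, lintegral_map (hH.fun_comp (by fun_prop)) (by fun_prop)]

variable (Q : Network X Y) [IsMarkovKernel Q] (i j : Fin m) (W : Kernel A B) [IsMarkovKernel W]
  {L : ℕ} (x : ∀ v, Fin L → X v × AtNode i A v)

/-- In a stack, the outputs of the point-to-point channels are those of the product channel. -/
theorem map_stack_withChannel_channel :
    (stack (withChannel Q i j W) L x).map (fun y l => (y j l).2 ⟨rfl⟩) =
      powChannel W L fun l => (x i l).2 ⟨rfl⟩ := by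
  change ((Measure.pi fun l : Fin L => withChannel Q i j W fun v => x v l).map
    fun y v l => y l v).map _ = _
  rw [Measure.map_map (by fun_prop) (measurable_layers L), powChannel_apply]
  have h : ∀ l, ((withChannel Q i j W) fun v => x v l).map (fun z => (z j).2 ⟨rfl⟩) =
      W ((x i l).2 ⟨rfl⟩) := by
    intro l
    rw [withChannel_apply, Measure.map_map (by fun_prop) (by fun_prop)]
    change Measure.map Prod.snd _ = _
    rw [← Measure.snd, Measure.snd_prod]
  simp only [← h]
  exact Measure.pi_map_pi (μ := fun l => withChannel Q i j W fun v => x v l)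
    (f := fun _ z => (z j).2 ⟨rfl⟩)
    fun l => Measurable.aemeasurable (by fun_prop)

/-- The layers `e a` of a stack, without the point-to-point channels, form a stack of copies
of `Q`. -/
theorem map_stack_withChannel_layers {N : ℕ} {e : Fin N → Fin L} (he : e.Injective) :
    (stack (withChannel Q i j W) L x).map (fun y v a => (y v (e a)).1) =
      stack Q N fun v a => (x v (e a)).1 := by
  have hm : Measurable fun (y : ∀ v, Fin L → Y v × AtNode j B v) v (a : Fin N) =>
      (y v (e a)).1 :=
    measurable_pi_lambda _ fun v => measurable_pi_lambda _ fun a =>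
      measurable_fst.comp ((measurable_pi_apply (e a)).comp (measurable_pi_apply v))
  change ((Measure.pi fun l : Fin L => withChannel Q i j W fun v => x v l).map
    fun y v l => y l v).map _ = (Measure.pi fun a => Q fun v => (x v (e a)).1).map _
  rw [Measure.map_map hm (measurable_layers L)]
  have hfst : Measurable fun (z : ∀ v, Y v × AtNode j B v) v => (z v).1 := by fun_prop
  have h : ∀ l, ((withChannel Q i j W) fun v => x v l).map (fun z v => (z v).1) =
      Q fun v => (x v l).1 := by
    intro l
    rw [withChannel_apply, Measure.map_map (by fun_prop) (by fun_prop)]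
    change Measure.map Prod.fst _ = _
    rw [← Measure.fst, Measure.fst_prod]
  simp only [← h]
  have h2 := map_pi_comp_injective (fun l => withChannel Q i j W fun v => x v l) he
  have h3 := Measure.pi_map_pi (μ := fun a => withChannel Q i j W fun v => x v (e a))
    (f := fun _ z v => (z v).1) fun l => hfst.aemeasurable
  have hfst' : Measurable fun (z : Fin N → ∀ v, Y v × AtNode j B v) a v => (z a v).1 :=
    measurable_pi_lambda _ fun a => hfst.comp (measurable_pi_apply a)
  rw [← h3, ← h2, Measure.map_map hfst' (by fun_prop),
    Measure.map_map (measurable_layers N) (hfst'.comp (by fun_prop))]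
  rfl

end Marginals

section BlockSolution

variable {m : ℕ} {X Y : Fin m → Type*} [∀ v, MeasurableSpace (X v)] [∀ v, MeasurableSpace (Y v)]
  {A B : Type*} [MeasurableSpace A] [MeasurableSpace B] {N k K L n : ℕ}

/-- The input of node `v` to `L` uses of the noisy network that simulate one time step of `K` copies
of an `N`-fold stack with a `k`-bit pipe. Layer `a` of copy `κ` takes the use `e (κ, a)` of the
network, the other uses get `x₀ v`; the bits of all copies are encoded jointly by `enc`. -/
noncomputable def blockInput (i : Fin m) (e : Fin K × Fin N → Fin L)
    (enc : (Fin K → Fin k → Bool) → Fin L → A)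
    (x₀ : ∀ v, X v) (v : Fin m) (x : Fin K → (Fin N → X v) × AtNode i (Fin k → Bool) v) :
    Fin L → X v × AtNode i A v :=
  fun l => (Function.extend e (fun p => (x p.1).1 p.2) (fun _ => x₀ v) l,
    fun h => enc (fun κ => (x κ).2 h) l)

/-- The output of copy `κ` at node `v`, obtained from the outputs of `L` uses of the noisy
network. -/
def copyOutput (j : Fin m) (e : Fin K × Fin N → Fin L) (dec : (Fin L → B) → Fin K → Fin k → Bool)
    (κ : Fin K) (v : Fin m) (y : Fin L → Y v × AtNode j B v) :
    (Fin N → Y v) × AtNode j (Fin k → Bool) v :=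
  (fun a => (y (e (κ, a))).1, fun h => dec (fun l => (y l).2 h) κ)

theorem measurable_blockInput (i : Fin m) (e : Fin K × Fin N → Fin L)
    (enc : (Fin K → Fin k → Bool) → Fin L → A) (x₀ : ∀ v, X v) (v : Fin m) :
    Measurable (blockInput i e enc x₀ v) := by
  refine measurable_pi_lambda _ fun l => Measurable.prodMk ?_ ?_
  · unfold Function.extend
    split_ifs <;> fun_prop
  · refine measurable_pi_lambda _ fun h => ?_
    have : Measurable fun c => enc c l := Measurable.of_discrete
    exact this.fun_comp (by fun_prop)

theorem measurable_copyOutput (j : Fin m) (e : Fin K × Fin N → Fin L)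
    {dec : (Fin L → B) → Fin K → Fin k → Bool} (hdec : Measurable dec) (κ : Fin K) (v : Fin m) :
    Measurable (copyOutput (Y := Y) j e dec κ v) := by
  refine Measurable.prodMk (by fun_prop) (measurable_pi_lambda _ fun h => ?_)
  exact (measurable_pi_apply κ).comp (hdec.fun_comp (by fun_prop))

/-- In one simulated time step, copy `κ` behaves like the stack with the noiseless pipe up to the
error probability `δ` of the channel code: unless the channel decoder errs, its output is the layers
of copy `κ` together with the bits sent. -/
theorem lintegral_copyOutput_le (Q : Network X Y) [IsMarkovKernel Q] (i j : Fin m) (W : Kernel A B)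
    [IsMarkovKernel W] {e : Fin K × Fin N → Fin L} (he : e.Injective)
    {enc : (Fin K → Fin k → Bool) → Fin L → A} {dec : (Fin L → B) → Fin K → Fin k → Bool}
    (hdec : Measurable dec) {δ : ℝ≥0∞} (hδ : ∀ c, powChannel W L (enc c) {y | dec y ≠ c} ≤ δ)
    (x₀ : ∀ v, X v) (x : ∀ v, Fin K → (Fin N → X v) × AtNode i (Fin k → Bool) v) (κ : Fin K)
    {H : (∀ v, (Fin N → Y v) × AtNode j (Fin k → Bool) v) → ℝ≥0∞} (hH : Measurable H)
    (hH1 : ∀ z, H z ≤ 1) :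
    ∫⁻ z, H (fun v => copyOutput j e dec κ v (z v))
        ∂stack (withChannel Q i j W) L (fun v => blockInput i e enc x₀ v (x v)) ≤
      ∫⁻ z, H z ∂withChannel (stack Q N) i j (bitPipe k) (fun v => x v κ) + δ := by
  set c : Fin K → Fin k → Bool := fun κ => (x i κ).2 ⟨rfl⟩ with hc
  set μ := stack (withChannel Q i j W) L (fun v => blockInput i e enc x₀ v (x v)) with hμ
  have hm : Measurable fun (y : ∀ v, Fin L → Y v × AtNode j B v) v (a : Fin N) =>
      (y v (e (κ, a))).1 :=
    measurable_pi_lambda _ fun v => measurable_pi_lambda _ fun a =>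
      measurable_fst.comp ((measurable_pi_apply (e (κ, a))).comp (measurable_pi_apply v))
  have hm2 : Measurable fun (y : ∀ v, Fin L → Y v × AtNode j B v) l => (y j l).2 ⟨rfl⟩ := by
    fun_prop
  have hmE : MeasurableSet {y | dec y ≠ c} := (hdec (measurableSet_singleton c)).compl
  have hmE' : MeasurableSet {z : ∀ v, Fin L → Y v × AtNode j B v |
      dec (fun l => (z j l).2 ⟨rfl⟩) ≠ c} := hm2 hmE
  have hlayers := map_stack_withChannel_layers Q i j W
    (fun v => blockInput i e enc x₀ v (x v)) (e := fun a => e (κ, a))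
    (he.comp (Prod.mk_right_injective κ))
  have hchan := map_stack_withChannel_channel Q i j W (fun v => blockInput i e enc x₀ v (x v))
  have hx : (fun v a => (blockInput i e enc x₀ v (x v) (e (κ, a))).1) = fun v => (x v κ).1 := by
    ext v a
    exact he.extend_apply (fun p : Fin K × Fin N => (x v p.1).1 p.2) (fun _ => x₀ v) (κ, a)
  rw [hx] at hlayers
  have hH0 : Measurable fun y : ∀ v, Fin N → Y v =>
      H fun v => (y v, fun _ => (x i κ).2 ⟨rfl⟩) := hH.fun_comp (by fun_prop)
  rw [lintegral_withChannel_bitPipe _ _ _ _ _ hH, ← hlayers, lintegral_map hH0 hm]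
  calc ∫⁻ z, H (fun v => copyOutput j e dec κ v (z v)) ∂μ
      ≤ ∫⁻ z, H (fun v => (fun a => (z v (e (κ, a))).1, fun _ => (x i κ).2 ⟨rfl⟩)) +
          {z | dec (fun l => (z j l).2 ⟨rfl⟩) ≠ c}.indicator 1 z ∂μ := by
        refine lintegral_mono fun z => ?_
        by_cases hz : dec (fun l => (z j l).2 ⟨rfl⟩) = c
        · refine le_add_right (le_of_eq ?_)
          congr 1
          ext1 v
          refine Prod.ext rfl (funext fun h => ?_)
          obtain ⟨rfl⟩ := h
          exact congrFun hz κ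
        · refine (hH1 _).trans ?_
          simp [hz]
    _ = _ + μ {z | dec (fun l => (z j l).2 ⟨rfl⟩) ≠ c} := by
        rw [lintegral_add_left (hH0.fun_comp hm), lintegral_indicator_one hmE']
    _ ≤ _ := by
        gcongr
        refine le_trans (le_of_eq ?_) (hδ c)
        refine (Measure.map_apply hm2 hmE).symm.trans ?_
        rw [hchan]
        rfl

/-- `K` copies of `S`, simulated on the `L`-fold stack of the noisy network. Copy `κ` is run with
the `κ`-th letters of the codewords `φ u v (w u v)` as its messages; the messages are recovered by
`ψ` from the estimates of all copies. -/
noncomputable def blockSolution {M M' : Fin m → Fin m → Type} [∀ u v, Finite (M u v)] {i j : Fin m}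
    (S : Solution (fun v => (Fin N → X v) × AtNode i (Fin k → Bool) v)
      (fun v => (Fin N → Y v) × AtNode j (Fin k → Bool) v) M n)
    (e : Fin K × Fin N → Fin L) (enc : (Fin K → Fin k → Bool) → Fin L → A)
    {dec : (Fin L → B) → Fin K → Fin k → Bool} (hdec : Measurable dec) (x₀ : ∀ v, X v)
    (φ : ∀ u v, M' u v → Fin K → M u v) (ψ : ∀ u v, (Fin K → M u v) → M' u v) :
    Solution (fun v => Fin L → X v × AtNode i A v) (fun v => Fin L → Y v × AtNode j B v) M' n where
  enc t v y w := blockInput i e enc x₀ v fun κ =>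
    S.enc t v (fun s => copyOutput j e dec κ v (y s)) fun v' => φ v v' (w v') κ
  dec u v y w := ψ u v fun κ =>
    S.dec u v (fun s => copyOutput j e dec κ v (y s)) fun v' => φ v v' (w v') κ
  measurable_enc t v w := by
    refine (measurable_blockInput i e enc x₀ v).comp (measurable_pi_lambda _ fun κ => ?_)
    refine (S.measurable_enc t v _).fun_comp (measurable_pi_lambda _ fun s => ?_)
    exact (measurable_copyOutput j e hdec κ v).comp (measurable_pi_apply s)
  measurable_dec u v w w' := by
    let _ : MeasurableSpace (M u v) := ⊤
    have h : Measurable fun (y : Fin n → Fin L → Y v × AtNode j B v) (κ : Fin K) =>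
        S.dec u v (fun s => copyOutput j e dec κ v (y s)) fun v' => φ v v' (w v') κ := by
      refine measurable_pi_lambda _ fun κ => ?_
      refine Measurable.fun_comp (g := fun y => S.dec u v y fun v' => φ v v' (w v') κ) ?_
        (measurable_pi_lambda _ fun s =>
          (measurable_copyOutput j e hdec κ v).comp (measurable_pi_apply s))
      exact measurable_to_countable' fun c => S.measurable_dec u v _ c
    have h2 : MeasurableSet {d : Fin K → M u v | ψ u v d = w'} := .of_discrete
    exact h h2

/-- Copy `κ` fails with at most the probability with which `S` fails on the letters given to that
copy, plus `n * δ` for the channel code. -/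
theorem prob_copy_error_le {M M' : Fin m → Fin m → Type} [∀ u v, Finite (M u v)] {i j : Fin m}
    (Q : Network X Y) [IsMarkovKernel Q] (W : Kernel A B) [IsMarkovKernel W]
    (S : Solution (fun v => (Fin N → X v) × AtNode i (Fin k → Bool) v)
      (fun v => (Fin N → Y v) × AtNode j (Fin k → Bool) v) M n)
    {e : Fin K × Fin N → Fin L} (he : e.Injective) {enc : (Fin K → Fin k → Bool) → Fin L → A}
    {dec : (Fin L → B) → Fin K → Fin k → Bool} (hdec : Measurable dec) {δ : ℝ≥0∞}
    (hδ : ∀ c, powChannel W L (enc c) {y | dec y ≠ c} ≤ δ) (x₀ : ∀ v, X v)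
    (φ : ∀ u v, M' u v → Fin K → M u v) (ψ : ∀ u v, (Fin K → M u v) → M' u v)
    (w : ∀ u v, M' u v) (κ : Fin K) (u v : Fin m) :
    (blockSolution S e enc hdec x₀ φ ψ).outputLaw (stack (withChannel Q i j W) L) w n le_rfl
        {y | S.dec u v (fun t => copyOutput j e dec κ v (y t v)) (fun v' => φ v v' (w v v') κ) ≠
          φ u v (w u v) κ} ≤
      S.outputLaw (withChannel (stack Q N) i j (bitPipe k)) (fun u v => φ u v (w u v) κ) n le_rfl
        {y | S.dec u v (fun t => y t v) (fun v' => φ v v' (w v v') κ) ≠ φ u v (w u v) κ} +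
        n * δ := by
  have hE : MeasurableSet {y : Fin n → ∀ v, (Fin N → Y v) × AtNode j (Fin k → Bool) v |
      S.dec u v (fun t => y t v) (fun v' => φ v v' (w v v') κ) ≠ φ u v (w u v) κ} :=
    (S.measurable_dec u v _ _).compl.preimage
      (by fun_prop : Measurable
        fun (y : Fin n → ∀ v, (Fin N → Y v) × AtNode j (Fin k → Bool) v) t => y t v)
  have hg : Measurable fun (y : ∀ v, Fin L → Y v × AtNode j B v) v =>
      copyOutput j e dec κ v (y v) :=
    measurable_pi_lambda _ fun v =>
      (measurable_copyOutput j e hdec κ v).comp (measurable_pi_apply v)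
  have h := Solution.lintegral_outputLaw_le S (blockSolution S e enc hdec x₀ φ ψ)
    (withChannel (stack Q N) i j (bitPipe k)) (stack (withChannel Q i j W) L)
    (fun u v => φ u v (w u v) κ) w hg (δ := δ)
    (fun t y H hH hH1 => lintegral_copyOutput_le Q i j W he hdec hδ x₀
      (fun v κ => S.enc t v (fun s => copyOutput j e dec κ v (y s v)) fun v' => φ v v' (w v v') κ)
      κ hH hH1) n le_rfl (measurable_one.indicator hE)
    (fun y => Set.indicator_le_self' (fun _ _ => zero_le) y)
  rw [lintegral_indicator_one hE] at h
  refine le_trans (le_of_eq ?_) h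
  rw [← lintegral_indicator_one]
  · rfl
  · exact hE.preimage (by
      refine measurable_pi_lambda _ fun t => hg.comp (measurable_pi_apply t) :
      Measurable fun (y : Fin n → ∀ v, Fin L → Y v × AtNode j B v) t v =>
        copyOutput j e dec κ v (y t v))

end BlockSolution

/-! ### The outer code -/

section OuterCode

variable {α : Type*} [Fintype α] [DecidableEq α] {K : ℕ}

/-- A crude volume bound: choose the set of positions that differ in at most `2 ^ K` ways. -/
theorem card_hammingBall_le [Nonempty α] (x : Fin K → α) (r : ℕ) :
    (Finset.univ.filter fun y => hammingDist x y ≤ r).card ≤ 2 ^ K * Fintype.card α ^ r := by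
  have hsub : (Finset.univ.filter fun y => hammingDist x y ≤ r) ⊆
      (Finset.univ.filter fun D : Finset (Fin K) => D.card ≤ r).biUnion fun D =>
        Fintype.piFinset fun κ => if κ ∈ D then Finset.univ else {x κ} := by
    intro y hy
    simp only [Finset.mem_filter, Finset.mem_univ, true_and, Finset.mem_biUnion,
      Fintype.mem_piFinset] at hy ⊢
    refine ⟨Finset.univ.filter fun κ => x κ ≠ y κ, hy, fun κ => ?_⟩
    split_ifs with h
    · exact Finset.mem_univ _
    · simpa [eq_comm] using h
  refine (Finset.card_le_card hsub).trans ((Finset.card_biUnion_le_card_mul _ _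
    (Fintype.card α ^ r) ?_).trans ?_)
  · intro D hD
    rw [Fintype.card_piFinset]
    have : ∀ κ, (if κ ∈ D then Finset.univ else {x κ} : Finset α).card =
        if κ ∈ D then Fintype.card α else 1 := by
      intro κ; split_ifs <;> simp
    simp only [this, Finset.prod_ite_mem, Finset.univ_inter, Finset.prod_const]
    exact Nat.pow_le_pow_right Fintype.card_pos (Finset.mem_filter.1 hD).2
  · refine Nat.mul_le_mul_right _ ((Finset.card_filter_le _ _).trans ?_)
    simp

/-- The Gilbert–Varshamov bound. -/
theorem exists_separated [Nonempty α] {T d : ℕ}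
    (h : T * (2 ^ K * Fintype.card α ^ (2 * d)) ≤ Fintype.card α ^ K) :
    ∃ φ : Fin T → Fin K → α, ∀ c c', c ≠ c' → 2 * d < hammingDist (φ c) (φ c') := by
  induction T with
  | zero => exact ⟨Fin.elim0, fun c => c.elim0⟩
  | succ T ih =>
    have hpos : 0 < 2 ^ K * Fintype.card α ^ (2 * d) := by
      have := Fintype.card_pos (α := α); positivity
    obtain ⟨φ, hφ⟩ := ih ((Nat.mul_le_mul_right _ T.le_succ).trans h)
    obtain ⟨x, hx⟩ : ∃ x, ∀ c, 2 * d < hammingDist (φ c) x := by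
      by_contra! hcon
      have h1 : (Finset.univ : Finset (Fin K → α)) ⊆ Finset.univ.biUnion fun c =>
          Finset.univ.filter fun y => hammingDist (φ c) y ≤ 2 * d := by
        intro y _
        simpa using hcon y
      have h2 := (Finset.card_le_card h1).trans
        (Finset.card_biUnion_le_card_mul _ _ _ fun c _ => card_hammingBall_le (φ c) (2 * d))
      rw [Finset.card_univ, Finset.card_univ, Fintype.card_fun, Fintype.card_fin,
        Fintype.card_fin] at h2
      rw [Nat.succ_mul] at h
      lia
    refine ⟨Fin.snoc φ x, fun c c' hcc => ?_⟩
    induction c using Fin.lastCases with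
    | last =>
      induction c' using Fin.lastCases with
      | last => exact absurd rfl hcc
      | cast c' => rw [hammingDist_comm]; simpa using hx c'
    | cast c =>
      induction c' using Fin.lastCases with
      | last => simpa using hx c
      | cast c' => simpa using hφ c c' fun h => hcc (congrArg _ h)

/-- A code of size `T` and length `K` that corrects `d` errors, with the Gilbert–Varshamov bound on
its size; a single codeword always exists. -/
theorem exists_outerCode [Nonempty α] {T d : ℕ} (hT : 0 < T)
    (h : T = 1 ∨ T * (2 ^ K * Fintype.card α ^ (2 * d)) ≤ Fintype.card α ^ K) :
    ∃ (φ : Fin T → Fin K → α) (ψ : (Fin K → α) → Fin T),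
      ∀ c y, hammingDist y (φ c) ≤ d → ψ y = c := by
  classical
  rcases h with rfl | h
  · exact ⟨fun _ _ => Classical.arbitrary α, fun _ => 0, fun c y _ => Subsingleton.elim _ _⟩
  obtain ⟨φ, hφ⟩ := exists_separated h
  refine ⟨φ, fun y => if hy : ∃ c, hammingDist y (φ c) ≤ d then hy.choose else ⟨0, hT⟩,
    fun c y hc => ?_⟩
  have hy : ∃ c, hammingDist y (φ c) ≤ d := ⟨c, hc⟩
  refine (dif_pos hy).trans ?_
  by_contra hne
  have h1 := hφ _ _ hne
  have h2 := hammingDist_triangle_left (φ hy.choose) (φ c) y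
  have h3 := hy.choose_spec
  lia

end OuterCode

/-- Markov's inequality for the number of events `F κ` that occur. -/
theorem mul_measure_le_sum {Ω ι : Type*} [MeasurableSpace Ω] [Fintype ι] (μ : Measure Ω)
    {E : Set Ω} {F : ι → Set Ω} (hF : ∀ κ, MeasurableSet (F κ))
    [∀ y, DecidablePred fun κ => y ∈ F κ]
    {d : ℕ} (h : ∀ y ∈ E, d < (Finset.univ.filter fun κ => y ∈ F κ).card) :
    ((d + 1 : ℕ) : ℝ≥0∞) * μ E ≤ ∑ κ, μ (F κ) := by
  have h1 : ∑ κ, μ (F κ) = ∫⁻ y, ∑ κ, (F κ).indicator 1 y ∂μ := by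
    rw [lintegral_finsetSum _ fun κ _ => measurable_one.indicator (hF κ)]
    exact Finset.sum_congr rfl fun κ _ => (lintegral_indicator_one (hF κ)).symm
  rw [h1]
  refine le_trans ?_ (mul_meas_ge_le_lintegral₀ (Measurable.aemeasurable
    (Finset.measurable_sum _ fun κ _ => measurable_one.indicator (hF κ))) ((d + 1 : ℕ) : ℝ≥0∞))
  gcongr
  intro y hy
  have h2 : ∑ κ, (F κ).indicator (1 : Ω → ℝ≥0∞) y =
      ((Finset.univ.filter fun κ => y ∈ F κ).card : ℝ≥0∞) := by
    rw [Finset.card_filter]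
    push_cast
    exact Finset.sum_congr rfl fun κ _ => by simp [Set.indicator_apply]
  simp only [Set.mem_ofPred_eq]
  rw [h2]
  exact_mod_cast h y hy

section Averaging

variable {m : ℕ} {X Y : Fin m → Type*} [∀ v, MeasurableSpace (X v)] [∀ v, MeasurableSpace (Y v)]
  {A B : Type*} [MeasurableSpace A] [MeasurableSpace B] {N k K L n : ℕ}

/-- If the outer code corrects `d` errors, a suitable shift of it makes the error probability of the
block solution at most about `K / (d + 1)` times that of `S`. The factor `m ^ 2` comes from choosing
one shift that is good for all pairs of nodes. -/
theorem exists_blockSolution {M : Fin m → Fin m → Type} [∀ u v, Fintype (M u v)]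
    [∀ u v, AddGroup (M u v)] [∀ u v, DecidableEq (M u v)] {i j : Fin m}
    (Q : Network X Y) [IsMarkovKernel Q] (W : Kernel A B) [IsMarkovKernel W]
    (S : Solution (fun v => (Fin N → X v) × AtNode i (Fin k → Bool) v)
      (fun v => (Fin N → Y v) × AtNode j (Fin k → Bool) v) M n) {lam : ℝ}
    (hS : S.IsGood (withChannel (stack Q N) i j (bitPipe k)) lam)
    {e : Fin K × Fin N → Fin L} (he : e.Injective) {enc : (Fin K → Fin k → Bool) → Fin L → A}
    {dec : (Fin L → B) → Fin K → Fin k → Bool} (hdec : Measurable dec) {δ : ℝ} (hδ0 : 0 ≤ δ)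
    (hδ : ∀ c, powChannel W L (enc c) {y | dec y ≠ c} ≤ ENNReal.ofReal δ) (x₀ : ∀ v, X v)
    {T : Fin m → Fin m → ℕ} (hT : ∀ u v, 0 < T u v)
    {φ : ∀ u v, Fin (T u v) → Fin K → M u v} {ψ : ∀ u v, (Fin K → M u v) → Fin (T u v)} {d : ℕ}
    (hψ : ∀ u v c y, hammingDist y (φ u v c) ≤ d → ψ u v y = c) :
    ∃ S' : Solution (fun v => Fin L → X v × AtNode i A v) (fun v => Fin L → Y v × AtNode j B v)
      (fun u v => Fin (T u v)) n, ∀ u v,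
        S'.errorProb (stack (withChannel Q i j W) L) u v ≤
          m ^ 2 * (K / (d + 1) * (lam + n * δ)) := by
  classical
  set G := withChannel (stack Q N) i j (bitPipe k) with hG
  have (u v : Fin m) : NeZero (T u v) := ⟨(hT u v).ne'⟩
  -- The outer code shifted by `s`; the same shift is used in all copies.
  let S' : (∀ u v, M u v) → Solution (fun v => Fin L → X v × AtNode i A v)
      (fun v => Fin L → Y v × AtNode j B v) (fun u v => Fin (T u v)) n := fun s =>
    blockSolution S e enc hdec x₀ (fun u v c κ => φ u v c κ + s u v)
      (fun u v y => ψ u v fun κ => y κ - s u v)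
  let err : Fin m → Fin m → (∀ u v, M u v) → ℝ := fun u v w =>
    (S.outputLaw G w n le_rfl).real {y | S.dec u v (fun t => y t v) (w v) ≠ w u v}
  -- An error after outer decoding requires more than `d` wrong copies.
  have hpoint : ∀ s w u v, ((S' s).outputLaw (stack (withChannel Q i j W) L) w n le_rfl).real
      {y | (S' s).dec u v (fun t => y t v) (w v) ≠ w u v} ≤
        (∑ κ, (err u v (fun u v => φ u v (w u v) κ + s u v) + n * δ)) / (d + 1) := by
    intro s w u v
    set μ := (S' s).outputLaw (stack (withChannel Q i j W) L) w n le_rfl with hμ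
    have hmeas : ∀ κ, MeasurableSet {y : Fin n → ∀ v, Fin L → Y v × AtNode j B v |
        S.dec u v (fun t => copyOutput j e dec κ v (y t v))
          (fun v' => φ v v' (w v v') κ + s v v') ≠ φ u v (w u v) κ + s u v} := fun κ =>
      (S.measurable_dec u v _ _).compl.preimage (measurable_pi_lambda _ fun t =>
        (measurable_copyOutput j e hdec κ v).comp
          ((measurable_pi_apply v).comp (measurable_pi_apply t)))
    have h1 := mul_measure_le_sum μ (d := d)
      (E := {y | (S' s).dec u v (fun t => y t v) (w v) ≠ w u v}) hmeas (by
        intro y hy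
        by_contra! hcon
        refine hy (hψ u v (w u v) _ (le_trans (Finset.card_le_card fun κ hκ => ?_) hcon))
        simp only [Finset.mem_filter, Finset.mem_univ, true_and, Set.mem_ofPred_eq] at hκ ⊢
        exact fun h => hκ (sub_eq_iff_eq_add.2 h))
    have h2 : ∀ κ, _ := fun κ => prob_copy_error_le Q W S he hdec hδ x₀
      (fun u v c κ => φ u v c κ + s u v) (fun u v y => ψ u v fun κ => y κ - s u v) w κ u v
    have h3 := h1.trans (Finset.sum_le_sum fun κ _ => h2 κ)
    have h4 := ENNReal.toReal_mono (by
      refine ENNReal.sum_ne_top.2 fun κ _ => ENNReal.add_ne_top.2 ⟨measure_ne_top _ _, ?_⟩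
      exact ENNReal.mul_ne_top (by simp) ENNReal.ofReal_ne_top) h3
    rw [ENNReal.toReal_mul, ENNReal.toReal_sum (fun κ _ => ENNReal.add_ne_top.2
      ⟨measure_ne_top _ _, ENNReal.mul_ne_top (by simp) ENNReal.ofReal_ne_top⟩)] at h4
    rw [le_div_iff₀ (by positivity), mul_comm]
    refine le_trans (le_of_eq ?_) (h4.trans (le_of_eq (Finset.sum_congr rfl fun κ _ => ?_)))
    · push_cast
      rfl
    · rw [ENNReal.toReal_add (measure_ne_top _ _)
        (ENNReal.mul_ne_top (by simp) ENNReal.ofReal_ne_top), ENNReal.toReal_mul,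
        ENNReal.toReal_ofReal hδ0]
      rfl
  -- Averaged over the shifts, the messages of each copy are uniform.
  have hshift : ∀ (w : ∀ u v, Fin (T u v)) κ u v,
      ∑ s : (∀ u v, M u v), err u v (fun u v => φ u v (w u v) κ + s u v) =
        Fintype.card (∀ u v, M u v) * S.errorProb G u v := by
    intro w κ u v
    have hc : (Fintype.card (∀ u v, M u v) : ℝ) ≠ 0 := by
      exact_mod_cast Fintype.card_ne_zero
    rw [Solution.errorProb, mul_div_cancel₀ _ hc]
    exact Equiv.sum_comp (Equiv.addLeft fun u v => φ u v (w u v) κ) (err u v)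
  have hsum : ∀ u v, ∑ s, (S' s).errorProb (stack (withChannel Q i j W) L) u v ≤
      Fintype.card (∀ u v, M u v) * (K / (d + 1) * (lam + n * δ)) := by
    intro u v
    have hc : (0 : ℝ) < Fintype.card (∀ u v, Fin (T u v)) := by exact_mod_cast Fintype.card_pos
    unfold Solution.errorProb
    rw [← Finset.sum_div, div_le_iff₀ hc, Finset.sum_comm]
    calc _ ≤ ∑ w : (∀ u v, Fin (T u v)), ∑ s : (∀ u v, M u v),
          (∑ κ, (err u v (fun u v => φ u v (w u v) κ + s u v) + n * δ)) / (d + 1) :=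
        Finset.sum_le_sum fun w _ => Finset.sum_le_sum fun s _ => hpoint s w u v
      _ = ∑ w : (∀ u v, Fin (T u v)), Fintype.card (∀ u v, M u v) *
            (K / (d + 1) * (S.errorProb G u v + n * δ)) := by
        refine Finset.sum_congr rfl fun w _ => ?_
        rw [← Finset.sum_div, Finset.sum_comm]
        simp only [Finset.sum_add_distrib, hshift, Finset.sum_const, Finset.card_univ,
          Fintype.card_fin, nsmul_eq_mul]
        ring
      _ ≤ _ := by
        rw [Finset.sum_const, Finset.card_univ, nsmul_eq_mul, mul_comm]
        gcongr
        exact (hS u v).le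
  obtain ⟨s, -, hs⟩ := Finset.exists_le_of_sum_le (s := Finset.univ)
    (f := fun s => ∑ u, ∑ v, (S' s).errorProb (stack (withChannel Q i j W) L) u v)
    (g := fun _ => (m : ℝ) ^ 2 * (K / (d + 1) * (lam + n * δ))) Finset.univ_nonempty (by
      rw [Finset.sum_comm]
      simp only [Finset.sum_comm (s := (Finset.univ : Finset (∀ u v, M u v)))
        (t := (Finset.univ : Finset (Fin m)))]
      refine (Finset.sum_le_sum fun u _ => Finset.sum_le_sum fun v _ => hsum u v).trans ?_
      simp only [Finset.sum_const, Finset.card_univ, Fintype.card_fin, nsmul_eq_mul]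
      exact le_of_eq (by ring))
  have hnn : ∀ u v, 0 ≤ (S' s).errorProb (stack (withChannel Q i j W) L) u v := fun u v =>
    div_nonneg (Finset.sum_nonneg fun _ _ => measureReal_nonneg) (Nat.cast_nonneg _)
  refine ⟨S' s, fun u v => le_trans ?_ hs⟩
  exact (Finset.single_le_sum (f := fun v => (S' s).errorProb _ u v) (fun v _ => hnn u v)
    (Finset.mem_univ v)).trans (Finset.single_le_sum
      (f := fun u => ∑ v, (S' s).errorProb (stack (withChannel Q i j W) L) u v)
      (fun u _ => Finset.sum_nonneg fun v _ => hnn u v) (Finset.mem_univ u))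

end Averaging

/-! ### Rates -/

theorem numMessages_pos (n : ℕ) (r : ℝ) : 0 < numMessages n r :=
  Nat.ceil_pos.2 (by positivity)

theorem numMessages_zero (n : ℕ) : numMessages n 0 = 1 := by simp [numMessages]

theorem le_numMessages (n : ℕ) (r : ℝ) : (2 : ℝ) ^ ((n : ℝ) * r) ≤ numMessages n r :=
  Nat.le_ceil _

theorem numMessages_le {n : ℕ} {r : ℝ} (hr : 0 ≤ r) :
    (numMessages n r : ℝ) ≤ 2 ^ ((n : ℝ) * r + 1) := by
  have h1 : (1 : ℝ) ≤ 2 ^ ((n : ℝ) * r) := Real.one_le_rpow (by norm_num) (by positivity)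
  have h2 := (Nat.ceil_lt_add_one (a := (2 : ℝ) ^ ((n : ℝ) * r)) (by positivity)).le
  rw [Real.rpow_add_one (by norm_num)]
  unfold numMessages
  linarith

/-- The size condition of the Gilbert–Varshamov bound, in logarithmic form. -/
theorem numMessages_mul_le {n K d q : ℕ} {r : ℝ} (hr : 0 ≤ r) (hq : 0 < q)
    (h : n * r + 1 + K + 2 * d * Real.logb 2 q ≤ K * Real.logb 2 q) :
    numMessages n r * (2 ^ K * q ^ (2 * d)) ≤ q ^ K := by
  have hq' : (0 : ℝ) < q := by exact_mod_cast hq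
  have h2 : (q : ℝ) = 2 ^ Real.logb 2 q := (Real.rpow_logb (by norm_num) (by norm_num) hq').symm
  have hpow : ∀ k : ℕ, (q : ℝ) ^ k = 2 ^ (k * Real.logb 2 q) := by
    intro k
    rw [mul_comm, Real.rpow_mul_natCast (by norm_num), ← h2]
  have h3 : (numMessages n r : ℝ) * (2 ^ K * q ^ (2 * d)) ≤ q ^ K := by
    rw [hpow, hpow, ← Real.rpow_natCast 2 K]
    refine (mul_le_mul_of_nonneg_right (numMessages_le hr) (by positivity)).trans ?_
    rw [← Real.rpow_add (by norm_num), ← Real.rpow_add (by norm_num)]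
    refine Real.rpow_le_rpow_of_exponent_le (by norm_num) ?_
    push_cast
    linarith
  exact_mod_cast h3

/-- The outer code is large enough for messages of rate `r`: blocks have length `n' / n`, of which a
fraction `ρ` is used by `⌊ρ (n' / n) / N⌋` copies, and a fraction `η` of wrong copies is
corrected. -/
theorem eventually_numMessages_mul_le {n N q : ℕ} (hn : 0 < n) (hN : 0 < N) (hq : 0 < q)
    {ρ η r : ℝ} (hρ : 0 < ρ) (hρ1 : ρ < 1) (hη : 0 < η) (hr : 0 < r)
    (h : n * N * r < ρ * ((1 - 2 * η) * Real.logb 2 q - 1)) :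
    ∀ᶠ n' : ℕ in atTop, numMessages n' r *
      (2 ^ ⌊ρ * (n' / n : ℕ) / N⌋₊ * q ^ (2 * ⌊η * ⌊ρ * (n' / n : ℕ) / N⌋₊⌋₊)) ≤
        q ^ ⌊ρ * (n' / n : ℕ) / N⌋₊ := by
  have hn' : (0 : ℝ) < n := by exact_mod_cast hn
  have hN' : (0 : ℝ) < N := by exact_mod_cast hN
  have hN1 : (1 : ℝ) ≤ N := by exact_mod_cast hN
  set lq := Real.logb 2 q with hlq
  have hlq0 : 0 ≤ lq := Real.logb_nonneg (by norm_num) (by exact_mod_cast hq)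
  set g := (1 - 2 * η) * lq - 1 with hg
  have hg0 : 0 < g := by
    by_contra! hcon
    have h1 : 0 < n * N * r := by positivity
    nlinarith
  have hslope : 0 < ρ * g / (n * N) - r := by
    rw [sub_pos, lt_div_iff₀ (by positivity)]
    linarith
  filter_upwards [(tendsto_natCast_atTop_atTop.const_mul_atTop hslope).eventually_ge_atTop
    (1 + 2 * g)] with n' hn'1
  refine numMessages_mul_le hr.le hq ?_
  set K := ⌊ρ * (n' / n : ℕ) / N⌋₊ with hK
  have hL : (n' : ℝ) / n - 1 ≤ (n' / n : ℕ) := by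
    have h1 : (n' : ℝ) < n * ((n' / n : ℕ) + 1) := by
      exact_mod_cast Nat.lt_mul_div_succ n' hn
    rw [sub_le_iff_le_add, div_le_iff₀ hn']
    linarith
  have hKge : ρ * n' / (n * N) - 2 ≤ K := by
    have h1 := (Nat.lt_floor_add_one (ρ * (n' / n : ℕ) / N)).le
    have h2 : ρ * ((n' : ℝ) / n - 1) / N ≤ ρ * (n' / n : ℕ) / N := by gcongr
    have h3 : ρ * ((n' : ℝ) / n - 1) / N = ρ * n' / (n * N) - ρ / N := by
      field_simp
    have h4 : ρ / N ≤ 1 := by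
      rw [div_le_one hN']; linarith
    linarith
  have hd : (⌊η * K⌋₊ : ℝ) ≤ η * K := Nat.floor_le (by positivity)
  have h5 : n' * r + 1 ≤ K * g := by
    have h6 : (ρ * n' / (n * N) - 2) * g ≤ K * g := by gcongr
    have h7 : (ρ * n' / (n * N) - 2) * g = (ρ * g / (n * N) - r) * n' + n' * r - 2 * g := by
      ring
    linarith
  have h8 : 2 * (⌊η * K⌋₊ : ℝ) * lq ≤ 2 * (η * K) * lq := by gcongr
  have h9 : K * g = K * lq - 2 * (η * K) * lq - K := by rw [hg]; ring
  linarith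

section RateRegion

variable {m : ℕ} {X Y : Fin m → Type*} [∀ v, MeasurableSpace (X v)] [∀ v, MeasurableSpace (Y v)]
  {A B : Type*} [MeasurableSpace A] [MeasurableSpace B]

/-- A single solution over the pipe with small error probability gives solutions over `W` of all
large blocklengths, at slightly smaller rates. -/
theorem eventually_exists_isGood [Nonempty A]
    (Q : Network X Y) [IsMarkovKernel Q] (W : Kernel A B) [IsMarkovKernel W]
    {i j : Fin m} {C : ℝ≥0} (hC : capacity W = C) {N n k : ℕ} (hN : 0 < N) (hn : 0 < n)
    (hk : (k : ℝ) ≤ N * C)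
    {M : Fin m → Fin m → Type} [∀ u v, Fintype (M u v)] [∀ u v, AddGroup (M u v)]
    (S : Solution (fun v => (Fin N → X v) × AtNode i (Fin k → Bool) v)
      (fun v => (Fin N → Y v) × AtNode j (Fin k → Bool) v) M n) {lam : ℝ} (hlam : 0 < lam)
    (hS : S.IsGood (withChannel (stack Q N) i j (bitPipe k)) lam)
    {R : Fin m → Fin m → ℝ} {ρ η lam' : ℝ} (hρ : 0 < ρ) (hρ1 : ρ < 1) (hη : 0 < η)
    (hR : ∀ u v, R u v = 0 ∨ 0 < R u v ∧
      n * N * R u v < ρ * ((1 - 2 * η) * Real.logb 2 (Fintype.card (M u v)) - 1))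
    (hlam' : m ^ 2 * (2 * lam / η) < lam') :
    ∀ᶠ n' : ℕ in atTop, ∃ S' : Solution (fun v => X v × AtNode i A v)
      (fun v => Y v × AtNode j B v) (fun u v => Fin (numMessages n' (R u v))) n',
      S'.IsGood (withChannel Q i j W) lam' := by
  classical
  have hn' : (0 : ℝ) < n := by exact_mod_cast hn
  have hN' : (0 : ℝ) < N := by exact_mod_cast hN
  have hN1 : (1 : ℝ) ≤ N := by exact_mod_cast hN
  have hdiv : Tendsto (fun n' => n' / n) atTop atTop := Nat.tendsto_div_const_atTop hn.ne'
  have hcode := hdiv.eventually (exists_code_of_rate_lt_capacity W hC hρ1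
    (δ := ENNReal.ofReal (lam / n)) (by simpa using div_pos hlam hn'))
  have hsize : ∀ᶠ n' : ℕ in atTop, ∀ u v, numMessages n' (R u v) = 1 ∨
      numMessages n' (R u v) * (2 ^ ⌊ρ * (n' / n : ℕ) / N⌋₊ *
        Fintype.card (M u v) ^ (2 * ⌊η * ⌊ρ * (n' / n : ℕ) / N⌋₊⌋₊)) ≤
        Fintype.card (M u v) ^ ⌊ρ * (n' / n : ℕ) / N⌋₊ := by
    rw [eventually_all]; intro u
    rw [eventually_all]; intro v
    rcases hR u v with h | ⟨h1, h2⟩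
    · exact .of_forall fun n' => Or.inl (by rw [h, numMessages_zero])
    · filter_upwards [eventually_numMessages_mul_le hn hN Fintype.card_pos hρ hρ1 hη h1 h2]
        with n' h using Or.inr h
  filter_upwards [hcode, hsize, hdiv.eventually_gt_atTop 0] with n' hcode hsize hL
  set L := n' / n with hLdef
  set K := ⌊ρ * (L : ℕ) / N⌋₊ with hK
  set d := ⌊η * K⌋₊ with hd
  have hL' : (0 : ℝ) < L := by exact_mod_cast hL
  have hKN : (K : ℝ) * N ≤ ρ * L := by
    rw [← le_div_iff₀ hN']
    exact Nat.floor_le (by positivity)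
  have hKNL : K * N ≤ L := by
    have : (K : ℝ) * N ≤ L := by nlinarith
    exact_mod_cast this
  obtain ⟨enc, dec, hdec, hδ⟩ := hcode (Fin K → Fin k → Bool) (by
    rw [Fintype.card_fun, Fintype.card_fun, Fintype.card_bool, Fintype.card_fin, Fintype.card_fin,
      ← pow_mul]
    push_cast
    rw [← Real.rpow_natCast]
    refine Real.rpow_le_rpow_of_exponent_le (by norm_num) ?_
    push_cast
    calc (k : ℝ) * K ≤ (N * C) * K := by gcongr
      _ = K * N * C := by ring
      _ ≤ ρ * L * C := by gcongr)
  let x₀ : ∀ v, X v := fun v => (S.enc ⟨0, hn⟩ v Fin.elim0 fun _ => 0).1 ⟨0, hN⟩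
  choose φ ψ hψ using fun u v => exists_outerCode (K := K) (d := d)
    (numMessages_pos n' (R u v)) (hsize u v)
  have he : (fun p : Fin K × Fin N => (finProdFinEquiv p).castLE hKNL).Injective :=
    (Fin.castLE_injective hKNL).comp finProdFinEquiv.injective
  obtain ⟨S', hS'⟩ := exists_blockSolution Q W S hS he hdec (div_pos hlam hn').le hδ x₀
    (fun u v => numMessages_pos n' (R u v)) hψ
  have hLn : L * n ≤ n' := Nat.div_mul_le_self n' n
  refine ⟨S'.unroll hL (fun v => (x₀ v, fun _ => Classical.arbitrary A)) n' hLn, fun u v => ?_⟩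
  rw [Solution.errorProb_unroll]
  refine (hS' u v).trans_lt (lt_of_le_of_lt ?_ hlam')
  have hKd : (K : ℝ) / (d + 1) ≤ 1 / η := by
    rw [div_le_div_iff₀ (by positivity) hη]
    have := (Nat.lt_floor_add_one (η * K)).le
    linarith
  rw [mul_div_cancel₀ _ hn'.ne']
  calc (m : ℝ) ^ 2 * (K / (d + 1) * (lam + lam)) ≤ m ^ 2 * (1 / η * (lam + lam)) := by gcongr
    _ = _ := by ring

/-- The common form of the two inclusions: `R` lies in the rate region over `W` if, for `n * N`
arbitrarily large, solutions of `N`-fold stacks with pipes of at most `N * C` bits achieve `R`. -/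
theorem mem_rateRegion_of_simulation [Nonempty A]
    (Q : Network X Y) [IsMarkovKernel Q] (W : Kernel A B) [IsMarkovKernel W]
    {i j : Fin m} {C : ℝ≥0} (hC : capacity W = C) {R : Fin m → Fin m → ℝ} (hR : IsRateVector R)
    (h : ∀ lam : ℝ, 0 < lam → ∀ b : ℕ, ∃ N n k : ℕ, 0 < N ∧ 0 < n ∧ b ≤ n * N ∧ (k : ℝ) ≤ N * C ∧
      ∃ (M : Fin m → Fin m → Type) (_ : ∀ u v, Fintype (M u v)) (_ : ∀ u v, AddGroup (M u v))
        (S : Solution (fun v => (Fin N → X v) × AtNode i (Fin k → Bool) v)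
          (fun v => (Fin N → Y v) × AtNode j (Fin k → Bool) v) M n),
        (∀ u v, n * N * R u v ≤ Real.logb 2 (Fintype.card (M u v))) ∧
        S.IsGood (withChannel (stack Q N) i j (bitPipe k)) lam) :
    R ∈ rateRegion (withChannel Q i j W) := by
  have hθ : ∀ θ : ℝ, 0 < θ → θ < 1 → θ • R ∈ rateRegion (withChannel Q i j W) := by
    intro θ hθ0 hθ1
    refine subset_closure ⟨⟨fun u v => mul_nonneg hθ0.le (hR.1 u v),
      fun v => by simp [hR.2 v]⟩, fun lam' hlam' => ?_⟩
    -- With these parameters `ρ * (1 - 2 * η) = ((1 + θ) / 2) ^ 2`, which exceeds `θ`.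
    set η := (1 - θ) / 4 with hη
    set ρ := (1 + θ) / 2 with hρ
    have hη0 : 0 < η := by rw [hη]; linarith
    have hgap : 0 < ρ * (1 - 2 * η) - θ := by rw [hη, hρ]; nlinarith [sq_pos_of_pos (sub_pos.2 hθ1)]
    -- The outer code loses one bit per letter, so the alphabet must be large compared to this gap.
    obtain ⟨b, hb⟩ : ∃ b : ℕ, ∀ u v, R u v = 0 ∨ ρ < b * R u v * (ρ * (1 - 2 * η) - θ) := by
      have : ∀ u v, ∀ᶠ b : ℕ in atTop, R u v = 0 ∨ ρ < b * R u v * (ρ * (1 - 2 * η) - θ) := by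
        intro u v
        rcases (hR.1 u v).eq_or_lt with h0 | h0
        · exact .of_forall fun _ => Or.inl h0.symm
        · have h1 := (tendsto_natCast_atTop_atTop (R := ℝ)).const_mul_atTop (mul_pos h0 hgap)
          filter_upwards [h1.eventually_gt_atTop ρ] with b hb
          exact Or.inr (by linarith)
      exact (eventually_all.2 fun u => eventually_all.2 fun v => this u v).exists
    have hm : (0 : ℝ) < 4 * (m ^ 2 + 1) := by positivity
    obtain ⟨N, n, k, hN, hn, hbn, hk, M, _, _, S, hM, hS⟩ :=
      h (lam' * η / (4 * (m ^ 2 + 1))) (by positivity) b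
    refine eventually_exists_isGood Q W hC hN hn hk S (by positivity) hS (ρ := ρ) (η := η)
      (by rw [hρ]; linarith) (by rw [hρ]; linarith) hη0 (fun u v => ?_) ?_
    · rcases hb u v with h0 | h0
      · left; simp [h0]
      · have hRpos : 0 < R u v := by
          refine (hR.1 u v).lt_of_ne fun h => ?_
          rw [← h] at h0
          have : 0 < ρ := by rw [hρ]; linarith
          simp at h0; linarith
        refine Or.inr ⟨mul_pos hθ0 hRpos, ?_⟩
        have h1 : (b : ℝ) ≤ n * N := by exact_mod_cast hbn
        have h2 : b * R u v * (ρ * (1 - 2 * η) - θ) ≤ n * N * R u v * (ρ * (1 - 2 * η) - θ) := by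
          gcongr
        have h3 : 0 ≤ ρ * (1 - 2 * η) := by linarith
        have h4 := mul_le_mul_of_nonneg_left (hM u v) h3
        change n * N * (θ * R u v) < _
        nlinarith
    · have h1 : (m : ℝ) ^ 2 * (2 * (lam' * η / (4 * (m ^ 2 + 1))) / η) =
          lam' * (m ^ 2 / (2 * (m ^ 2 + 1))) := by
        field_simp; ring
      rw [h1]
      have h2 : (m : ℝ) ^ 2 / (2 * (m ^ 2 + 1)) < 1 := by
        rw [div_lt_one (by positivity)]
        nlinarith [sq_nonneg (m : ℝ)]
      nlinarith
  have hlim : Tendsto (fun θ : ℝ => θ • R) (nhdsWithin 1 (Set.Iio 1)) (nhds R) := by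
    have : Tendsto (fun θ : ℝ => θ • R) (nhds 1) (nhds ((1 : ℝ) • R)) :=
      (continuous_id.smul continuous_const).tendsto 1
    rw [one_smul] at this
    exact this.mono_left nhdsWithin_le_nhds
  refine isClosed_closure.mem_of_tendsto hlim ?_
  filter_upwards [Ioo_mem_nhdsLT (show (0 : ℝ) < 1 by norm_num)] with θ h using hθ θ h.1 h.2

/-- A solution for `Q` with a bit pipe, as a solution for the one-fold stack with that pipe. -/
def Solution.toStackOne {i j : Fin m} {k n : ℕ} {M : Fin m → Fin m → Type}
    (S : Solution (fun v => X v × AtNode i (Fin k → Bool) v)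
      (fun v => Y v × AtNode j (Fin k → Bool) v) M n) :
    Solution (fun v => (Fin 1 → X v) × AtNode i (Fin k → Bool) v)
      (fun v => (Fin 1 → Y v) × AtNode j (Fin k → Bool) v) M n where
  enc t v y w := (fun _ => (S.enc t v (fun s => ((y s).1 0, (y s).2)) w).1,
    (S.enc t v (fun s => ((y s).1 0, (y s).2)) w).2)
  dec u v y w := S.dec u v (fun s => ((y s).1 0, (y s).2)) w
  measurable_enc t v w := by
    have h : Measurable fun y : Fin t → (Fin 1 → Y v) × AtNode j (Fin k → Bool) v =>
        S.enc t v (fun s => ((y s).1 0, (y s).2)) w :=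
      (S.measurable_enc t v w).fun_comp (by fun_prop)
    fun_prop
  measurable_dec u v w w' := (S.measurable_dec u v w w').preimage
    (by fun_prop : Measurable fun (y : Fin n → (Fin 1 → Y v) × AtNode j (Fin k → Bool) v) s =>
      ((y s).1 0, (y s).2))

theorem Solution.errorProb_toStackOne_le (Q : Network X Y) [IsMarkovKernel Q]
    {i j : Fin m} {k n : ℕ} {M : Fin m → Fin m → Type} [∀ u v, Fintype (M u v)]
    (S : Solution (fun v => X v × AtNode i (Fin k → Bool) v)
      (fun v => Y v × AtNode j (Fin k → Bool) v) M n) (u v : Fin m) :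
    S.toStackOne.errorProb (withChannel (stack Q 1) i j (bitPipe k)) u v ≤
      S.errorProb (withChannel Q i j (bitPipe k)) u v := by
  unfold Solution.errorProb
  gcongr with w
  have hE : MeasurableSet {y : Fin n → ∀ v, Y v × AtNode j (Fin k → Bool) v |
      S.dec u v (fun t => y t v) (w v) ≠ w u v} :=
    (S.measurable_dec u v _ _).compl.preimage
      (by fun_prop : Measurable fun (y : Fin n → ∀ v, Y v × AtNode j (Fin k → Bool) v) t => y t v)
  have hg : Measurable fun (y : ∀ v, (Fin 1 → Y v) × AtNode j (Fin k → Bool) v) v =>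
      ((y v).1 0, (y v).2) :=
    measurable_pi_lambda _ fun v => by fun_prop
  have h := Solution.lintegral_outputLaw_le S S.toStackOne (withChannel Q i j (bitPipe k))
    (withChannel (stack Q 1) i j (bitPipe k)) w w hg (δ := 0) (fun t y H hH hH1 => by
      rw [lintegral_withChannel_bitPipe _ _ _ _ _ (hH.fun_comp hg),
        lintegral_withChannel_bitPipe _ _ _ _ _ hH, add_zero,
        Solution.lintegral_stack _ _ _ (hH.fun_comp (by
          refine measurable_pi_lambda _ fun v => ?_
          fun_prop))]
      refine le_of_eq ?_
      exact (measurePreserving_eval (fun _ : Fin 1 => Q fun v =>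
        (S.inputs w t (fun s v => ((y s v).1 0, (y s v).2)) v).1) 0).lintegral_comp
          (f := fun z => H fun v => (z v, fun _ =>
            (S.inputs w t (fun s v => ((y s v).1 0, (y s v).2)) i).2 ⟨rfl⟩))
          (hH.fun_comp (by fun_prop))) n le_rfl
    (measurable_one.indicator hE) (fun y => Set.indicator_le_self' (fun _ _ => zero_le) y)
  rw [lintegral_indicator_one hE, mul_zero, add_zero] at h
  refine ENNReal.toReal_mono (measure_ne_top _ _) (le_trans (le_of_eq ?_) h)
  rw [← lintegral_indicator_one]
  · rfl
  · exact hE.preimage (measurable_pi_lambda _ fun t => hg.comp (measurable_pi_apply t))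

end RateRegion

end NetEquiv

open NetEquiv
theorem mainTheorem4 {m : ℕ} {X Y : Fin m → Type*}
    [∀ v, MeasurableSpace (X v)] [∀ v, MeasurableSpace (Y v)]
    {A B : Type*} [MeasurableSpace A] [MeasurableSpace B] [Nonempty A]
    (Q : Network X Y) [IsMarkovKernel Q] (W : Kernel A B) [IsMarkovKernel W]
    (i j : Fin m) (C : ℝ≥0) (hC : capacity W = C) :
    stackedRateRegion (fun N => stackWithBitPipe Q i j C N) ⊆
        rateRegion (withChannel Q i j W) ∧
      ∀ k : ℕ, C = k →
        rateRegion (withChannel Q i j (bitPipe k)) ⊆ rateRegion (withChannel Q i j W) := by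
  refine ⟨closure_minimal ?_ isClosed_closure, fun k hk => closure_minimal ?_ isClosed_closure⟩
  · rintro R ⟨hR, hach⟩
    refine mem_rateRegion_of_simulation Q W hC hR fun lam hlam b => ?_
    obtain ⟨N, ⟨n, hn, S, hS⟩, hNb⟩ := ((hach lam hlam).and (eventually_ge_atTop (b + 1))).exists
    have (u v : Fin m) : NeZero (numMessages n (R u v)) := ⟨(numMessages_pos n (R u v)).ne'⟩
    refine ⟨N, n, ⌊(N : ℝ≥0) * C⌋₊, by lia, hn, by nlinarith, ?_, _, inferInstance, inferInstance,
      S, fun u v => ?_, hS⟩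
    · exact_mod_cast Nat.floor_le (zero_le (a := (N : ℝ≥0) * C))
    · rw [Fintype.card_fun, Fintype.card_fin, Fintype.card_fin, Nat.cast_pow, Real.logb_pow,
        mul_right_comm, mul_comm]
      gcongr
      rw [Real.le_logb_iff_rpow_le (by norm_num) (by exact_mod_cast numMessages_pos n (R u v))]
      exact le_numMessages n (R u v)
  · rintro R ⟨hR, hach⟩
    refine mem_rateRegion_of_simulation Q W hC hR fun lam hlam b => ?_
    obtain ⟨n, ⟨S, hS⟩, hnb⟩ := ((hach lam hlam).and (eventually_ge_atTop (b + 1))).exists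
    have (u v : Fin m) : NeZero (numMessages n (R u v)) := ⟨(numMessages_pos n (R u v)).ne'⟩
    refine ⟨1, n, k, one_pos, by lia, by lia, by simp [hk], _, inferInstance, inferInstance,
      S.toStackOne, fun u v => ?_, fun u v => (S.errorProb_toStackOne_le Q u v).trans_lt (hS u v)⟩
    rw [Fintype.card_fin, Nat.cast_one, mul_one,
      Real.le_logb_iff_rpow_le (by norm_num) (by exact_mod_cast numMessages_pos n (R u v))]
    exact le_numMessages n (R u v)
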